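/- Let $\mathbb T=\mathbb R/\mathbb Z$, let $\mathrm{Diff}^k(\mathbb T)$ be the set of orientation-preserving $C^k$-diffeomorphisms of $\mathbb T$, with $\mathrm{Diff}^1(\mathbb T)$ carrying the $C^1$-topology and its Borel $\sigma$-algebra, and write $\mathcal S_\psi=\psi'''/\psi'-\tfrac32(\psi''/\psi')^2$. Let $\sigma>0$. For $\alpha\in\mathbb R\cup i\mathbb R$, a Radon measure $\mu$ on $\mathrm{Diff}^1(\mathbb T)$ is called an (unquotiented Virasoro) $\alpha$-orbital measure if for every $\psi\in\mathrm{Diff}^3(\mathbb T)$ the measure $\psi^*\mu(A)=\mu(\{\psi\circ\phi:\phi\in A\})$ satisfies $$\frac{d\psi^*\mu}{d\mu}(\phi)=\exp\Big\{\frac1{\sigma^2}\int_{\mathbb T}\big[\mathcal S_\psi(\phi(\tau))+2\alpha^2\big(\psi'(\phi(\tau))^2-1\big)\big]\phi'(\tau)^2\,d\tau\Big\}.$$ Let $\mu$ be an $\alpha_0$-orbital measure for some $\alpha_0$ with $\alpha_0^2\in\mathbb R$, and for $\alpha^2\in\mathbb R$ put $$d\mu^{\alpha}(\phi)=\exp\Big\{\frac{2(\alpha^2-\alpha_0^2)}{\sigma^2}\int_{\mathbb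 T}\phi'(\tau)^2\,d\tau\Big\}\,d\mu(\phi).$$ For $t_0\in\mathbb T$ let $[F(\phi)]^{\alpha,t_0}_{\sigma^2}=\int F(\phi-\phi(t_0))\,d\mu^{\alpha}(\phi)$ be the unnormalised expectation under the $\alpha$-orbital measure pinned at $t_0$. Let $t_0\in\mathbb T$ and let $\alpha\in\mathbb R\cup i\mathbb R$ with $\alpha^2<\pi^2$. Put $$f_\alpha(t)=\frac12\Big(\frac{1}{\tan\frac\alpha2}\tan\big(\alpha(t-\tfrac12)\big)+1\Big),\qquad t\in[0,1],$$ with the conventions $f_\alpha(t)=t$ and $\alpha/\sin\alpha=1$ if $\alpha=0$. Then $f_\alpha$ is a real-valued orientation-preserving $C^3$-diffeomorphism of $[0,1]$ with $f_\alpha(0)=0$, $f_\alpha(1)=1$ and constant Schwarzian derivative $\mathcal S_{f_\alpha}=2\alpha^2$, it induces an element of $\mathrm{Diff}^1(\mathbb T)$, and $$\big[G(f_\alpha\circ\phi)\big]^{\alpha,t_0}_{\sigma^2}=\frac{\alpha}{\sin\alpha}\Big[G(\phi)\exp\Big\{\frac{8\sin^2(\alpha/2)}{\sigma^2}\,\phi'(t_0)\Big\}\Big]^{0,t_0}_{\sigma^2}$$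 for every measurable $G:\mathrm{Diff}^1(\mathbb T)\to[0,\infty]$ (both sides may be infinite), and likewise for every measurable $G:\mathrm{Diff}^1(\mathbb T)\to\mathbb R$ for which one of the two sides is absolutely integrable; in that case so is the other. -/

import Mathlib

open MeasureTheory Set
open scoped ENNReal

noncomputable section

/-- `g : ℝ → ℝ` is the lift of an orientation preserving `C¹`-diffeomorphism of `ℝ / ℤ`. -/
structure IsCircleDiffLift (g : ℝ → ℝ) : Prop where
  contDiff : ContDiff ℝ 1 g
  map_add_one : ∀ x, g (x + 1) = g x + 1
  deriv_pos : ∀ x, 0 < deriv g x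

/-- `Diff¹(𝕋)`, `𝕋 = ℝ / ℤ`: the orientation preserving `C¹`-diffeomorphisms of the unit circle. -/
structure CircleDiff where
  toFun : UnitAddCircle → UnitAddCircle
  exists_lift : ∃ g : ℝ → ℝ, IsCircleDiffLift g ∧
    ∀ x : ℝ, toFun (x : UnitAddCircle) = (g x : UnitAddCircle)

namespace CircleDiff

instance : CoeFun CircleDiff (fun _ => UnitAddCircle → UnitAddCircle) := ⟨CircleDiff.toFun⟩

/-- A lift of `φ` to `ℝ`; it is unique up to adding an integer constant. -/
def lift (φ : CircleDiff) : ℝ → ℝ := Classical.choose φ.exists_lift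

theorem isLift (φ : CircleDiff) : IsCircleDiffLift φ.lift :=
  (Classical.choose_spec φ.exists_lift).1

theorem coe_lift (φ : CircleDiff) (x : ℝ) : φ (x : UnitAddCircle) = (φ.lift x : UnitAddCircle) :=
  (Classical.choose_spec φ.exists_lift).2 x

theorem continuous_toFun (φ : CircleDiff) : Continuous φ.toFun := by
  apply continuous_coinduced_dom.mpr
  have h : (φ.toFun ∘ fun x : ℝ => (x : UnitAddCircle))
      = fun x : ℝ => (φ.lift x : UnitAddCircle) := funext φ.coe_lift
  exact h ▸ (AddCircle.continuous_mk' (1 : ℝ)).comp φ.isLift.contDiff.continuous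

theorem periodic_deriv_lift (φ : CircleDiff) : Function.Periodic (deriv φ.lift) 1 := by
  intro x
  have h : (fun y => φ.lift (y + 1)) = fun y => φ.lift y + 1 := funext φ.isLift.map_add_one
  have h1 := deriv_comp_add_const (f := φ.lift) (a := (1 : ℝ)) (x := x)
  rw [← h1, h, deriv_add_const]

/-- The derivative `φ' : 𝕋 → ℝ`. -/
def derivative (φ : CircleDiff) : C(UnitAddCircle, ℝ) where
  toFun := φ.periodic_deriv_lift.lift
  continuous_toFun := by
    apply continuous_coinduced_dom.mpr
    exact φ.isLift.contDiff.continuous_deriv le_rfl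

/-- `φ` as a continuous map. -/
def toContinuousMap (φ : CircleDiff) : C(UnitAddCircle, UnitAddCircle) :=
  ⟨φ.toFun, φ.continuous_toFun⟩

/-- The `C¹` topology: uniform convergence of `φ` and of `φ'`. -/
instance : TopologicalSpace CircleDiff :=
  TopologicalSpace.induced (fun φ => (φ.toContinuousMap, φ.derivative)) inferInstance

instance : MeasurableSpace CircleDiff := borel CircleDiff

instance : BorelSpace CircleDiff := ⟨rfl⟩

/-- Membership in `Diff³(𝕋)`. -/
def IsC3 (ψ : CircleDiff) : Prop := ContDiff ℝ 3 ψ.lift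

/-- The composition `ψ ∘ φ`. -/
def comp (ψ φ : CircleDiff) : CircleDiff where
  toFun := ψ.toFun ∘ φ.toFun
  exists_lift := by
    refine ⟨ψ.lift ∘ φ.lift, ⟨ψ.isLift.contDiff.comp φ.isLift.contDiff, fun x => ?_, fun x => ?_⟩,
      fun x => ?_⟩
    · simp only [Function.comp_apply, φ.isLift.map_add_one, ψ.isLift.map_add_one]
    · rw [deriv_comp x (ψ.isLift.contDiff.differentiable one_ne_zero _)
        (φ.isLift.contDiff.differentiable one_ne_zero _)]
      exact mul_pos (ψ.isLift.deriv_pos _) (φ.isLift.deriv_pos _)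
    · simp only [Function.comp_apply, φ.coe_lift, ψ.coe_lift]

/-- The rotated diffeomorphism `φ + θ`. -/
def rotate (φ : CircleDiff) (θ : UnitAddCircle) : CircleDiff where
  toFun := fun t => φ t + θ
  exists_lift := by
    obtain ⟨c, rfl⟩ := QuotientAddGroup.mk_surjective θ
    refine ⟨fun x => φ.lift x + c, ⟨φ.isLift.contDiff.add contDiff_const, fun x => ?_, fun x => ?_⟩,
      fun x => ?_⟩
    · rw [φ.isLift.map_add_one]; ring
    · rw [deriv_add_const]; exact φ.isLift.deriv_pos x
    · rw [φ.coe_lift]; rfl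

/-- The Dirichlet energy `∫_𝕋 φ'(τ)² dτ`. -/
def energy (φ : CircleDiff) : ℝ := ∫ τ in (0 : ℝ)..1, deriv φ.lift τ ^ 2

end CircleDiff

/-- The Schwarzian derivative `f''' / f' - (3/2) (f'' / f')²`. -/
def schwarzian (f : ℝ → ℝ) (x : ℝ) : ℝ :=
  iteratedDeriv 3 f x / deriv f x - 3 / 2 * (iteratedDeriv 2 f x / deriv f x) ^ 2

/-- The logarithm of the density `dψ^*μ / dμ` at `φ`, for `a = α²`. -/
def orbitalExponent (σ a : ℝ) (ψ φ : CircleDiff) : ℝ :=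
  1 / σ ^ 2 * ∫ τ in (0 : ℝ)..1,
    (schwarzian ψ.lift (φ.lift τ) + 2 * a * (deriv ψ.lift (φ.lift τ) ^ 2 - 1))
      * deriv φ.lift τ ^ 2

/-- `μ` is an unquotiented Virasoro `α`-orbital measure, `a = α²`: a Radon measure on `Diff¹(𝕋)`
whose pull-back `ψ^*μ (A) = μ (ψ ∘ A)` under every `ψ ∈ Diff³(𝕋)` has the prescribed density. -/
structure IsOrbitalMeasure (σ a : ℝ) (μ : Measure CircleDiff) : Prop where
  locallyFinite : IsLocallyFiniteMeasure μ
  innerRegular : μ.InnerRegular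
  change_of_variables : ∀ ψ : CircleDiff, ψ.IsC3 → ∀ A : Set CircleDiff, MeasurableSet A →
    μ ((fun φ => ψ.comp φ) '' A)
      = ∫⁻ φ in A, ENNReal.ofReal (Real.exp (orbitalExponent σ a ψ φ)) ∂μ

/-- The family of measures generated by an orbital measure `μ` with parameter `a₀ = α₀²`:
the member with parameter `a = α²` has density `exp {2 (a - a₀) / σ² ∫ φ'²}` with respect
to `μ`. -/
def orbitalFamily (σ a₀ : ℝ) (μ : Measure CircleDiff) (a : ℝ) : Measure CircleDiff :=
  μ.withDensity fun φ => ENNReal.ofReal (Real.exp (2 * (a - a₀) / σ ^ 2 * φ.energy))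

/-- The map `φ ↦ φ - φ(t₀)`. -/
def pin (t₀ : UnitAddCircle) (φ : CircleDiff) : CircleDiff := φ.rotate (-φ t₀)

theorem CircleDiff.derivative_rotate (φ : CircleDiff) (θ : UnitAddCircle) :
    (φ.rotate θ).derivative = φ.derivative := by
  obtain ⟨c, rfl⟩ := QuotientAddGroup.mk_surjective θ
  have hint : ∀ x, ∃ n : ℤ, (φ.rotate (c : UnitAddCircle)).lift x - (φ.lift x + c) = n := by
    intro x
    have h : ((φ.rotate (c : UnitAddCircle)).lift x : UnitAddCircle)
        = ((φ.lift x + c : ℝ) : UnitAddCircle) := by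
      rw [← CircleDiff.coe_lift]
      change φ (x : UnitAddCircle) + (c : UnitAddCircle) = _
      rw [φ.coe_lift]; rfl
    have h2 := sub_eq_zero.mpr h
    rw [← AddCircle.coe_sub] at h2
    obtain ⟨n, hn⟩ := AddCircle.coe_eq_zero_iff (1 : ℝ) |>.mp h2
    exact ⟨n, by rw [← hn]; simp⟩
  choose n hn using hint
  have hcont : Continuous fun x => ((n x : ℤ) : ℝ) := by
    have : (fun x => ((n x : ℤ) : ℝ))
        = fun x => (φ.rotate (c : UnitAddCircle)).lift x - (φ.lift x + c) :=
      funext fun x => (hn x).symm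
    rw [this]
    exact (CircleDiff.isLift _).contDiff.continuous.sub
      (φ.isLift.contDiff.continuous.add continuous_const)
  have hn' : Continuous n := Int.isClosedEmbedding_coe_real.isEmbedding.continuous_iff.mpr hcont
  have hconst : ∀ x, n x = n 0 := fun x => (isPreconnected_univ (α := ℝ)).constant
    hn'.continuousOn (mem_univ x) (mem_univ 0)
  have hl : (φ.rotate (c : UnitAddCircle)).lift = fun x => φ.lift x + (c + n 0) := by
    funext x
    have := hn x
    rw [hconst x] at this
    linarith
  ext t
  obtain ⟨x, rfl⟩ := QuotientAddGroup.mk_surjective t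
  change deriv (φ.rotate (c : UnitAddCircle)).lift x = deriv φ.lift x
  rw [hl, deriv_add_const]

theorem continuous_pin (t₀ : UnitAddCircle) : Continuous (pin t₀) := by
  have h0 : Continuous fun φ : CircleDiff => (φ.toContinuousMap, φ.derivative) :=
    continuous_induced_dom
  refine continuous_induced_rng.mpr (Continuous.prodMk ?_ ?_)
  · have h1 : Continuous fun φ : CircleDiff => φ.toContinuousMap := h0.fst
    have h2 : Continuous fun φ : CircleDiff =>
        φ.toContinuousMap + ContinuousMap.const UnitAddCircle (-φ.toContinuousMap t₀) :=
      h1.add (ContinuousMap.continuous_const'.comp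
        ((continuous_eval_const (F := C(UnitAddCircle, UnitAddCircle)) t₀).comp h1).neg)
    exact h2
  · have h3 : (fun φ : CircleDiff => (pin t₀ φ).derivative) = fun φ => φ.derivative :=
      funext fun φ => φ.derivative_rotate _
    exact h3 ▸ h0.snd

/-- The measure pinned at `t₀`: the law of `φ - φ(t₀)` under `μ`
(`pin t₀` is measurable, being continuous). -/
def pinned (t₀ : UnitAddCircle) (μ : Measure CircleDiff) : Measure CircleDiff :=
  μ.map (pin t₀)

/-- The function `f_α`. For `α` real or purely imaginary with `α² < π²` and `t ∈ [0, 1]`,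
the complex number in the definition is real. -/
def fAlpha (α : ℂ) (t : ℝ) : ℝ :=
  if α = 0 then t
  else (1 / 2 * (1 / Complex.tan (α / 2) * Complex.tan (α * ((t : ℂ) - 1 / 2)) + 1)).re

/-- `α / sin α`, equal to `1` at `α = 0`; real for `α` real or purely imaginary. -/
def alphaDivSin (α : ℂ) : ℝ := if α = 0 then 1 else (α / Complex.sin α).re

/-- The defect coefficient `8 sin²(α/2)`; real for `α` real or purely imaginary. -/
def defectCoeff (α : ℂ) : ℝ := (8 * Complex.sin (α / 2) ^ 2).re

/-- `f ∈ Diff³[0, 1]`. -/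
structure IsIntervalDiff3 (f : ℝ → ℝ) : Prop where
  contDiffOn : ContDiffOn ℝ 3 f (Icc 0 1)
  map_zero : f 0 = 0
  map_one : f 1 = 1
  deriv_pos : ∀ t ∈ Icc (0 : ℝ) 1, 0 < derivWithin f (Icc 0 1) t

end

/-!
Rotation invariance makes `φ(t₀)` uniformly distributed on the circle and independent of the pinned
diffeomorphism `φ - φ(t₀)`. The quasi-invariance of an orbital measure under `ψ ∈ Diff³(𝕋)`
therefore descends, for almost every `θ`, to the pinned measure under `ψ(· + θ) - ψ(θ)`, with
`ψ'(θ)` as an additional factor of the Jacobian.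

The derivative of `f_α` has a kink at `0`, so `f_α` is not in `Diff³(𝕋)`. Up to a constant
`f_α'` is `u⁻²`, where `u'' = -α² u` away from `0` and `u'` jumps at `0`. Replacing the Dirac mass
in `u''` by a bump gives maps `ψₙ ∈ Diff³(𝕋)` that converge to `f_α`, with Schwarzian derivatives
converging to `2α²` plus a Dirac mass at `0`. Changing variables in `∫ 𝒮(φ(τ)) φ'(τ)² dτ` makes the
Dirac mass contribute a multiple of `φ'(t₀)` when `φ(t₀) = 0`. Fatou's lemma turns the
limit into an inequality between measures, and the same argument for `ψₙ⁻¹ → f_α⁻¹` gives the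
reverse one.
-/

noncomputable section

open Filter Topology

section ExpWeight

variable {X Y : Type*} [MeasurableSpace X] [MeasurableSpace Y]

/-- The measure `e^g μ`. Unlike `Measure.tilted` it is not normalised, since it may be infinite. -/
def expWeight (μ : Measure X) (g : X → ℝ) : Measure X :=
  μ.withDensity fun x => ENNReal.ofReal (Real.exp (g x))

theorem measurable_ofReal_exp {g : X → ℝ} (hg : Measurable g) :
    Measurable fun x => ENNReal.ofReal (Real.exp (g x)) :=
  hg.exp.ennreal_ofReal

theorem lintegral_expWeight (μ : Measure X) {g : X → ℝ} (hg : Measurable g) (H : X → ℝ≥0∞) :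
    ∫⁻ x, H x ∂expWeight μ g = ∫⁻ x, ENNReal.ofReal (Real.exp (g x)) * H x ∂μ :=
  lintegral_withDensity_eq_lintegral_mul_non_measurable μ (measurable_ofReal_exp hg)
    (ae_of_all _ fun _ => ENNReal.ofReal_lt_top) H

theorem integrable_expWeight_iff (μ : Measure X) {g : X → ℝ} (hg : Measurable g) {H : X → ℝ} :
    Integrable H (expWeight μ g) ↔ Integrable (fun x => H x * Real.exp (g x)) μ := by
  rw [expWeight, integrable_withDensity_iff (measurable_ofReal_exp hg)
    (ae_of_all _ fun _ => ENNReal.ofReal_lt_top)]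
  simp only [ENNReal.toReal_ofReal (Real.exp_pos _).le]

theorem integral_expWeight (μ : Measure X) {g : X → ℝ} (hg : Measurable g) (H : X → ℝ) :
    ∫ x, H x ∂expWeight μ g = ∫ x, H x * Real.exp (g x) ∂μ := by
  rw [expWeight, integral_withDensity_eq_integral_toReal_smul (measurable_ofReal_exp hg)
    (ae_of_all _ fun _ => ENNReal.ofReal_lt_top)]
  simp only [ENNReal.toReal_ofReal (Real.exp_pos _).le, smul_eq_mul, mul_comm]

instance (μ : Measure X) [SFinite μ] (g : X → ℝ) : SFinite (expWeight μ g) := by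
  unfold expWeight
  infer_instance

theorem expWeight_zero (μ : Measure X) : expWeight μ 0 = μ := by
  simp [expWeight]

theorem expWeight_expWeight (μ : Measure X) {g h : X → ℝ} (hg : Measurable g)
    (hh : Measurable h) : expWeight (expWeight μ g) h = expWeight μ (g + h) := by
  unfold expWeight
  rw [← withDensity_mul μ (measurable_ofReal_exp hg) (measurable_ofReal_exp hh)]
  congr 1
  ext x
  rw [Pi.mul_apply, Pi.add_apply, Real.exp_add, ENNReal.ofReal_mul (Real.exp_pos _).le]

theorem expWeight_const_add (μ : Measure X) (c : ℝ) {g : X → ℝ} (hg : Measurable g) :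
    expWeight μ (fun x => c + g x) = ENNReal.ofReal (Real.exp c) • expWeight μ g := by
  rw [expWeight, expWeight, ← withDensity_smul _ (measurable_ofReal_exp hg)]
  congr 1
  ext x
  rw [Pi.smul_apply, smul_eq_mul, Real.exp_add, ENNReal.ofReal_mul (Real.exp_pos _).le]

theorem expWeight_congr_ae {μ : Measure X} {g h : X → ℝ} (hgh : g =ᵐ[μ] h) :
    expWeight μ g = expWeight μ h :=
  withDensity_congr_ae (hgh.mono fun _ hx => by simp only [hx])

theorem expWeight_mono_measure {μ ν : Measure X} (h : μ ≤ ν) {g : X → ℝ} :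
    expWeight μ g ≤ expWeight ν g := by
  refine Measure.le_iff.mpr fun A hA => ?_
  rw [expWeight, expWeight, withDensity_apply _ hA, withDensity_apply _ hA]
  exact lintegral_mono' (Measure.restrict_mono_measure h A) le_rfl

theorem map_expWeight_comp (μ : Measure X) {T : X → Y} (hT : Measurable T) {g : Y → ℝ}
    (hg : Measurable g) : (expWeight μ (g ∘ T)).map T = expWeight (μ.map T) g := by
  ext A hA
  rw [Measure.map_apply hT hA, expWeight, expWeight, withDensity_apply _ (hT hA),
    withDensity_apply _ hA, setLIntegral_map hA (measurable_ofReal_exp hg) hT]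
  rfl

theorem map_expWeight_apply (μ : Measure X) {T : X → Y} (hT : Measurable T) {g : X → ℝ}
    (hg : Measurable g) {A : Set Y} (hA : MeasurableSet A) :
    (expWeight μ g).map T A
      = ∫⁻ x, ENNReal.ofReal (Real.exp (g x)) * A.indicator 1 (T x) ∂μ := by
  rw [← lintegral_indicator_one hA, lintegral_map (measurable_one.indicator hA) hT,
    lintegral_expWeight μ hg]

section MapEqSMul

variable {μ : Measure X} {ν : Measure Y} {T : X → Y} {g : Y → ℝ} {c : ℝ}

theorem lintegral_comp_of_map_eq_smul_expWeight (hT : Measurable T) (hg : Measurable g)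
    (h : μ.map T = ENNReal.ofReal c • expWeight ν g) {H : Y → ℝ≥0∞} (hH : Measurable H) :
    ∫⁻ x, H (T x) ∂μ
      = ENNReal.ofReal c * ∫⁻ y, H y * ENNReal.ofReal (Real.exp (g y)) ∂ν := by
  rw [← lintegral_map hH hT, h, lintegral_smul_measure, smul_eq_mul, lintegral_expWeight ν hg]
  simp only [mul_comm]

theorem integrable_comp_iff_of_map_eq_smul_expWeight (hT : Measurable T) (hg : Measurable g)
    (hc : 0 < c) (h : μ.map T = ENNReal.ofReal c • expWeight ν g) {H : Y → ℝ}
    (hH : Measurable H) :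
    Integrable (fun x => H (T x)) μ ↔ Integrable (fun y => H y * Real.exp (g y)) ν := by
  rw [← integrable_expWeight_iff ν hg, ← integrable_smul_measure (μ := expWeight ν g)
      (ENNReal.ofReal_pos.mpr hc).ne' ENNReal.ofReal_ne_top, ← h,
    integrable_map_measure hH.aestronglyMeasurable hT.aemeasurable]
  rfl

theorem integral_comp_of_map_eq_smul_expWeight (hT : Measurable T) (hg : Measurable g)
    (hc : 0 ≤ c) (h : μ.map T = ENNReal.ofReal c • expWeight ν g) {H : Y → ℝ}
    (hH : Measurable H) :
    ∫ x, H (T x) ∂μ = c * ∫ y, H y * Real.exp (g y) ∂ν := by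
  rw [← integral_map hT.aemeasurable hH.aestronglyMeasurable, h, integral_smul_measure,
    ENNReal.toReal_ofReal hc, smul_eq_mul, integral_expWeight ν hg]

end MapEqSMul

end ExpWeight

/-- `T` transports `e^E μ` to `μ`: the exponent `E` is the logarithm of the Jacobian of `T` with
respect to `μ`, and `E = 0` means that `T` preserves `μ`. -/
structure HasLogJacobian {X : Type*} [MeasurableSpace X] (μ : Measure X) (T : X → X)
    (E : X → ℝ) : Prop where
  measurable : Measurable T
  measurable_exponent : Measurable E
  map_eq : (expWeight μ E).map T = μ

namespace HasLogJacobian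

variable {X : Type*} [MeasurableSpace X] {μ : Measure X} {T S : X → X} {E g : X → ℝ}

theorem map_expWeight_add_comp (h : HasLogJacobian μ T E) (hg : Measurable g) :
    (expWeight μ (E + g ∘ T)).map T = expWeight μ g := by
  rw [← expWeight_expWeight μ h.measurable_exponent (hg.comp h.measurable),
    map_expWeight_comp _ h.measurable hg, h.map_eq]

theorem expWeight_measure (h : HasLogJacobian μ T E) (hg : Measurable g) :
    HasLogJacobian (expWeight μ g) T (E + g ∘ T - g) where
  measurable := h.measurable
  measurable_exponent :=
    (h.measurable_exponent.add (hg.comp h.measurable)).sub hg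
  map_eq := by
    rw [expWeight_expWeight μ hg ((h.measurable_exponent.add (hg.comp h.measurable)).sub hg),
      add_sub_cancel, h.map_expWeight_add_comp hg]

theorem inverse (h : HasLogJacobian μ T E) (hS : Measurable S)
    (hST : Function.LeftInverse S T) : HasLogJacobian μ S (-(E ∘ S)) where
  measurable := hS
  measurable_exponent := (h.measurable_exponent.comp hS).neg
  map_eq := by
    have hE : E + (-(E ∘ S)) ∘ T = 0 := by
      ext x
      simp [hST x]
    rw [← h.map_expWeight_add_comp (h.measurable_exponent.comp hS).neg, hE, expWeight_zero,
      Measure.map_map hS h.measurable, hST.comp_eq_id, Measure.map_id]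

theorem map_of_semiconj {Y : Type*} [MeasurableSpace Y] (h : HasLogJacobian μ T E) {k : X → Y}
    (hk : Measurable k) {T' : Y → Y} (hT' : Measurable T') {E' : Y → ℝ} (hE' : Measurable E')
    (hkT : Function.Semiconj k T T') (hkE : E' ∘ k = E) :
    HasLogJacobian (μ.map k) T' E' where
  measurable := hT'
  measurable_exponent := hE'
  map_eq := by
    rw [← map_expWeight_comp μ hk hE', hkE, Measure.map_map hT' hk, ← hkT.comp_eq,
      ← Measure.map_map hk h.measurable, h.map_eq]

theorem measure_preimage_of_leftInverse (h : HasLogJacobian μ T E) (hS : Measurable S)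
    (hST : Function.LeftInverse S T) {B : Set X} (hB : MeasurableSet B) :
    μ (S ⁻¹' B) = ∫⁻ x in B, ENNReal.ofReal (Real.exp (E x)) ∂μ := by
  conv_lhs => rw [← h.map_eq]
  rw [Measure.map_apply h.measurable (hS hB), ← preimage_comp, hST.comp_eq_id, preimage_id,
    expWeight, withDensity_apply _ hB]

section SkewProduct

variable {Y : Type*} [MeasurableSpace Y] {ν : Measure Y} {R : X → Y → Y} {D : X × Y → ℝ}

theorem prod_preimage_prod_of_leftInverse [SFinite μ] [SFinite ν]
    (hD : HasLogJacobian (μ.prod ν) (fun p => (T p.1, R p.1 p.2)) D) (hS : Measurable S)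
    (hST : Function.LeftInverse S T) {B : Set X} (hB : MeasurableSet B) {A : Set Y}
    (hA : MeasurableSet A) :
    (μ.prod ν) ((S ⁻¹' B) ×ˢ A)
      = ∫⁻ x in B, (expWeight ν fun y => D (x, y)).map (R x) A ∂μ := by
  let w (p : X × Y) : ℝ≥0∞ := ENNReal.ofReal (Real.exp (D p)) * A.indicator 1 (R p.1 p.2)
  have hw : Measurable w := (measurable_ofReal_exp hD.measurable_exponent).mul
    ((measurable_one.indicator hA).comp hD.measurable.snd)
  have hfiber (x : X) : (expWeight ν fun y => D (x, y)).map (R x) A = ∫⁻ y, w (x, y) ∂ν :=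
    map_expWeight_apply ν (hD.measurable.snd.comp measurable_prodMk_left)
      (hD.measurable_exponent.comp measurable_prodMk_left) hA
  have hindicator (p : X × Y) : ENNReal.ofReal (Real.exp (D p)) *
      ((S ⁻¹' B) ×ˢ A).indicator 1 (T p.1, R p.1 p.2) = (B ×ˢ univ).indicator w p := by
    by_cases hp : p.1 ∈ B <;> by_cases hA : R p.1 p.2 ∈ A <;>
      simp [w, hp, hA, hST p.1]
  conv_lhs => rw [← hD.map_eq]
  rw [map_expWeight_apply _ hD.measurable hD.measurable_exponent ((hS hB).prod hA)]
  simp only [hindicator, hfiber]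
  rw [lintegral_indicator (hB.prod MeasurableSet.univ), setLIntegral_prod _ hw.aemeasurable]
  simp only [Measure.restrict_univ]

/-- Disintegration along the base: the test sets are the products of `T '' B`, `B ⊆ X`, with `A`. -/
theorem ae_map_expWeight_fiber_apply [SigmaFinite μ] [SFinite ν]
    (hE : HasLogJacobian μ T E) (hS : Measurable S) (hST : Function.LeftInverse S T)
    (hD : HasLogJacobian (μ.prod ν) (fun p => (T p.1, R p.1 p.2)) D)
    {A : Set Y} (hA : MeasurableSet A) :
    ∀ᵐ x ∂μ, (expWeight ν fun y => -E x + D (x, y)).map (R x) A = ν A := by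
  have hR (x : X) : Measurable (R x) := hD.measurable.snd.comp measurable_prodMk_left
  have hDx (x : X) : Measurable fun y => D (x, y) :=
    hD.measurable_exponent.comp measurable_prodMk_left
  have hexpE := measurable_ofReal_exp hE.measurable_exponent
  have hfiber : (fun x => ENNReal.ofReal (Real.exp (E x)) * ν A) =ᵐ[μ]
      fun x => (expWeight ν fun y => D (x, y)).map (R x) A := by
    refine ae_eq_of_forall_setLIntegral_eq_of_sigmaFinite (hexpE.mul_const _) ?_
      fun B hB _ => ?_
    · simp only [map_expWeight_apply ν (hR _) (hDx _) hA]
      exact ((measurable_ofReal_exp hD.measurable_exponent).mul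
        ((measurable_one.indicator hA).comp hD.measurable.snd)).lintegral_prod_right'
    · rw [lintegral_mul_const _ hexpE, ← hE.measure_preimage_of_leftInverse hS hST hB,
        ← hD.prod_preimage_prod_of_leftInverse hS hST hB hA, Measure.prod_prod]
  filter_upwards [hfiber] with x hx
  rw [expWeight_const_add ν _ (hDx x), Measure.map_smul, Measure.smul_apply, ← hx, smul_eq_mul,
    ← mul_assoc, ← ENNReal.ofReal_mul (Real.exp_pos _).le, ← Real.exp_add, neg_add_cancel,
    Real.exp_zero, ENNReal.ofReal_one, one_mul]

end SkewProduct

end HasLogJacobian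

theorem le_map_expWeight_of_map_inverse_le {X : Type*} [MeasurableSpace X] {μ : Measure X}
    {T S : X → X} {E : X → ℝ} (hT : Measurable T) (hS : Measurable S) (hE : Measurable E)
    (hTS : Function.LeftInverse T S) (h : (expWeight μ (-(E ∘ S))).map S ≤ μ) :
    μ ≤ (expWeight μ E).map T := by
  have hmap : μ.map S ≤ expWeight μ E := calc
    μ.map S = (expWeight μ (-(E ∘ S) + E ∘ S)).map S := by rw [neg_add_cancel, expWeight_zero]
    _ = expWeight ((expWeight μ (-(E ∘ S))).map S) E := by
        rw [← expWeight_expWeight μ (hE.comp hS).neg (hE.comp hS), map_expWeight_comp _ hS hE]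
    _ ≤ expWeight μ E := expWeight_mono_measure h
  calc μ = (μ.map S).map T := by rw [Measure.map_map hT hS, hTS.comp_eq_id, Measure.map_id]
    _ ≤ (expWeight μ E).map T := Measure.map_mono hmap hT

theorem mul_indicator_le_liminf {X : Type*} [TopologicalSpace X] {U : Set X} (hU : IsOpen U)
    {x : ℕ → X} {y : X} (hx : Tendsto x atTop (𝓝 y)) {c : ℕ → ℝ≥0∞} {d : ℝ≥0∞}
    (hc : Tendsto c atTop (𝓝 d)) :
    d * U.indicator 1 y ≤ liminf (fun n => c n * U.indicator 1 (x n)) atTop := by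
  by_cases hy : y ∈ U
  · have h : Tendsto (fun n => c n * U.indicator 1 (x n)) atTop (𝓝 d) :=
      hc.congr' ((hx.eventually_mem (hU.mem_nhds hy)).mono fun n hn => by simp [hn])
    rw [h.liminf_eq]
    simp [hy]
  · simp [hy]

theorem map_expWeight_apply_le_of_tendsto {X Y : Type*} [MeasurableSpace X] [TopologicalSpace Y]
    [MeasurableSpace Y] [OpensMeasurableSpace Y] {μ : Measure X} {T : ℕ → X → Y} {T' : X → Y}
    {E : ℕ → X → ℝ} {E' : X → ℝ} (hT : ∀ n, Measurable (T n)) (hT' : Measurable T')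
    (hE : ∀ n, Measurable (E n)) (hE' : Measurable E')
    (hTlim : ∀ᵐ x ∂μ, Tendsto (fun n => T n x) atTop (𝓝 (T' x)))
    (hElim : ∀ᵐ x ∂μ, Tendsto (fun n => E n x) atTop (𝓝 (E' x)))
    {U : Set Y} (hU : IsOpen U) {M : ℝ≥0∞} (hM : ∀ n, (expWeight μ (E n)).map (T n) U ≤ M) :
    (expWeight μ E').map T' U ≤ M := by
  let w (n : ℕ) (x : X) : ℝ≥0∞ := ENNReal.ofReal (Real.exp (E n x)) * U.indicator 1 (T n x)
  have hw (n : ℕ) : Measurable (w n) := (measurable_ofReal_exp (hE n)).mul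
    ((measurable_one.indicator hU.measurableSet).comp (hT n))
  calc (expWeight μ E').map T' U
      = ∫⁻ x, ENNReal.ofReal (Real.exp (E' x)) * U.indicator 1 (T' x) ∂μ :=
        map_expWeight_apply μ hT' hE' hU.measurableSet
    _ ≤ ∫⁻ x, liminf (fun n => w n x) atTop ∂μ := by
        refine lintegral_mono_ae ?_
        filter_upwards [hTlim, hElim] with x hTx hEx
        exact mul_indicator_le_liminf hU hTx (ENNReal.tendsto_ofReal hEx.rexp)
    _ ≤ liminf (fun n => ∫⁻ x, w n x ∂μ) atTop := lintegral_liminf_le hw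
    _ ≤ M := liminf_le_of_frequently_le' (Frequently.of_forall fun n => by
        rw [← map_expWeight_apply μ (hT n) (hE n) hU.measurableSet]
        exact hM n)

theorem measure_le_of_forall_isOpen {X : Type*} [TopologicalSpace X] [MeasurableSpace X]
    {μ ν : Measure X} [ν.OuterRegular] (h : ∀ U, IsOpen U → μ U ≤ ν U) : μ ≤ ν := by
  refine Measure.le_intro fun A _ _ => ?_
  rw [A.measure_eq_iInf_isOpen ν]
  exact le_iInf₂ fun U hAU => le_iInf fun hU => (measure_mono hAU).trans (h U hU)

theorem exists_seq_tendsto_of_ae {X : Type*} [TopologicalSpace X] [FirstCountableTopology X]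
    [MeasurableSpace X] {μ : Measure X} [μ.IsOpenPosMeasure] {p : ℕ → X → Prop}
    (h : ∀ n, ∀ᵐ x ∂μ, p n x) (x₀ : X) :
    ∃ x : ℕ → X, Tendsto x atTop (𝓝 x₀) ∧ ∀ n, p n (x n) := by
  obtain ⟨x, hx, hlim⟩ := mem_closure_iff_seq_limit.mp
    (Measure.dense_of_ae (ae_all_iff.mpr h) x₀)
  exact ⟨x, hlim, fun n => hx n n⟩

namespace CircleDiff

@[ext] theorem ext {φ ψ : CircleDiff} (h : ∀ t, φ t = ψ t) : φ = ψ := by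
  cases φ; cases ψ; congr; exact funext h

theorem exists_int_lift_eq_add (φ : CircleDiff) {g : ℝ → ℝ} (hg : Continuous g)
    (h : ∀ x : ℝ, φ (x : UnitAddCircle) = (g x : UnitAddCircle)) :
    ∃ n : ℤ, ∀ x, φ.lift x = g x + n := by
  have hint (x : ℝ) : ∃ n : ℤ, φ.lift x - g x = n := by
    have hzero : ((φ.lift x - g x : ℝ) : UnitAddCircle) = 0 := by
      rw [AddCircle.coe_sub, ← φ.coe_lift, h, sub_self]
    obtain ⟨n, hn⟩ := AddCircle.coe_eq_zero_iff (1 : ℝ) |>.mp hzero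
    exact ⟨n, by rw [← hn]; simp⟩
  choose n hn using hint
  have hcont : Continuous n := by
    refine Int.isClosedEmbedding_coe_real.isEmbedding.continuous_iff.mpr ?_
    change Continuous fun x => ((n x : ℤ) : ℝ)
    rw [← funext hn]
    exact φ.isLift.contDiff.continuous.sub hg
  have hconst (x : ℝ) : n x = n 0 :=
    isPreconnected_univ.constant hcont.continuousOn (mem_univ x) (mem_univ 0)
  exact ⟨n 0, fun x => by rw [← hconst x, ← hn x]; ring⟩

theorem deriv_lift_eq (φ : CircleDiff) {g : ℝ → ℝ} (hg : Continuous g)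
    (h : ∀ x : ℝ, φ (x : UnitAddCircle) = (g x : UnitAddCircle)) :
    deriv φ.lift = deriv g := by
  obtain ⟨n, hn⟩ := φ.exists_int_lift_eq_add hg h
  funext x
  rw [funext hn, deriv_add_const]

theorem derivative_coe (φ : CircleDiff) (x : ℝ) :
    φ.derivative (x : UnitAddCircle) = deriv φ.lift x := rfl

theorem derivative_pos (φ : CircleDiff) (t : UnitAddCircle) : 0 < φ.derivative t := by
  obtain ⟨x, rfl⟩ := QuotientAddGroup.mk_surjective t
  exact φ.isLift.deriv_pos x

theorem hasDerivAt_lift (φ : CircleDiff) (x : ℝ) :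
    HasDerivAt φ.lift (φ.derivative (x : UnitAddCircle)) x :=
  (φ.isLift.contDiff.differentiable one_ne_zero x).hasDerivAt

/-- The circle diffeomorphism with a given lift. -/
def ofLift (g : ℝ → ℝ) (hg : IsCircleDiffLift g) : CircleDiff where
  toFun := Function.Periodic.lift (f := fun x : ℝ => (g x : UnitAddCircle)) (c := (1 : ℝ))
    fun x => by
      change ((g (x + 1) : ℝ) : UnitAddCircle) = (g x : UnitAddCircle)
      rw [hg.map_add_one, AddCircle.coe_add_period]
  exists_lift := ⟨g, hg, fun _ => rfl⟩

theorem ofLift_coe {g : ℝ → ℝ} (hg : IsCircleDiffLift g) (x : ℝ) :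
    ofLift g hg (x : UnitAddCircle) = (g x : UnitAddCircle) := rfl

theorem derivative_ofLift {g : ℝ → ℝ} (hg : IsCircleDiffLift g) (x : ℝ) :
    (ofLift g hg).derivative (x : UnitAddCircle) = deriv g x := by
  rw [derivative_coe, (ofLift g hg).deriv_lift_eq hg.contDiff.continuous (ofLift_coe hg)]

end CircleDiff

namespace IsCircleDiffLift

variable {g : ℝ → ℝ}

theorem strictMono (hg : IsCircleDiffLift g) : StrictMono g :=
  strictMono_of_deriv_pos hg.deriv_pos

theorem surjective (hg : IsCircleDiffLift g) : Function.Surjective g :=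
  let G : CircleDeg1Lift := ⟨⟨g, hg.strictMono.monotone⟩, hg.map_add_one⟩
  hg.contDiff.continuous.surjective G.tendsto_atTop G.tendsto_atBot

/-- A lift as a homeomorphism of the line. -/
def homeo (hg : IsCircleDiffLift g) : ℝ ≃ₜ ℝ :=
  (hg.strictMono.orderIsoOfSurjective g hg.surjective).toHomeomorph

theorem homeo_apply (hg : IsCircleDiffLift g) (x : ℝ) : hg.homeo x = g x := rfl

theorem hasDerivAt (hg : IsCircleDiffLift g) (x : ℝ) : HasDerivAt g (deriv g x) x :=
  (hg.contDiff.differentiable one_ne_zero x).hasDerivAt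

theorem homeo_symm (hg : IsCircleDiffLift g) : IsCircleDiffLift hg.homeo.symm where
  contDiff := hg.homeo.contDiff_symm_deriv (f' := deriv g) (fun x => (hg.deriv_pos x).ne')
    hg.hasDerivAt hg.contDiff
  map_add_one x := by
    rw [Homeomorph.symm_apply_eq, hg.homeo_apply, hg.map_add_one, ← hg.homeo_apply,
      Homeomorph.apply_symm_apply]
  deriv_pos x := by
    have h := (hg.hasDerivAt (hg.homeo.symm x)).of_local_left_inverse (f := g)
      hg.homeo.symm.continuous.continuousAt (hg.deriv_pos _).ne'
      (Eventually.of_forall fun y => by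
        rw [← hg.homeo_apply, Homeomorph.apply_symm_apply])
    rw [h.deriv]
    exact inv_pos.mpr (hg.deriv_pos _)

end IsCircleDiffLift

theorem isCircleDiffLift_add_const (c : ℝ) : IsCircleDiffLift fun x => x + c where
  contDiff := by fun_prop
  map_add_one x := by ring
  deriv_pos x := by simp

namespace CircleDiff

instance : Mul CircleDiff := ⟨comp⟩

instance : One CircleDiff := ⟨ofLift _ (isCircleDiffLift_add_const 0)⟩

instance : Inv CircleDiff := ⟨fun φ => ofLift _ φ.isLift.homeo_symm⟩

@[simp] theorem mul_apply (ψ φ : CircleDiff) (t : UnitAddCircle) : (ψ * φ) t = ψ (φ t) := rfl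

@[simp] theorem one_apply (t : UnitAddCircle) : (1 : CircleDiff) t = t := by
  obtain ⟨x, rfl⟩ := QuotientAddGroup.mk_surjective t
  exact (ofLift_coe (isCircleDiffLift_add_const 0) x).trans (by rw [add_zero])

instance : Group CircleDiff :=
  Group.ofLeftAxioms (fun _ _ _ => rfl) (fun φ => ext fun t => one_apply (φ t)) fun φ => by
    ext t
    obtain ⟨x, rfl⟩ := QuotientAddGroup.mk_surjective t
    change ofLift _ φ.isLift.homeo_symm (φ (x : UnitAddCircle)) = (1 : CircleDiff) x
    rw [coe_lift, ofLift_coe, ← φ.isLift.homeo_apply, Homeomorph.symm_apply_apply, one_apply]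

@[simp] theorem inv_apply_apply (φ : CircleDiff) (t : UnitAddCircle) : φ⁻¹ (φ t) = t := by
  rw [← mul_apply, inv_mul_cancel, one_apply]

@[simp] theorem apply_inv_apply (φ : CircleDiff) (t : UnitAddCircle) : φ (φ⁻¹ t) = t := by
  rw [← mul_apply, mul_inv_cancel, one_apply]

@[simp] theorem rotate_apply (φ : CircleDiff) (θ t : UnitAddCircle) :
    φ.rotate θ t = φ t + θ := rfl

theorem derivative_mul (ψ φ : CircleDiff) (t : UnitAddCircle) :
    (ψ * φ).derivative t = ψ.derivative (φ t) * φ.derivative t := by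
  obtain ⟨x, rfl⟩ := QuotientAddGroup.mk_surjective t
  have hlift : deriv (ψ * φ).lift = deriv (ψ.lift ∘ φ.lift) :=
    (ψ * φ).deriv_lift_eq
      (ψ.isLift.contDiff.continuous.comp φ.isLift.contDiff.continuous) fun x => by
        simp only [mul_apply, Function.comp_apply, φ.coe_lift, ψ.coe_lift]
  change deriv (ψ * φ).lift x = ψ.derivative (φ (x : UnitAddCircle)) * φ.derivative x
  rw [hlift, φ.coe_lift]
  exact ((ψ.hasDerivAt_lift _).comp x (φ.hasDerivAt_lift x)).deriv

theorem derivative_one (t : UnitAddCircle) : (1 : CircleDiff).derivative t = 1 := by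
  obtain ⟨x, rfl⟩ := QuotientAddGroup.mk_surjective t
  exact (derivative_ofLift (isCircleDiffLift_add_const 0) x).trans (by simp)

theorem derivative_inv (φ : CircleDiff) (t : UnitAddCircle) :
    φ⁻¹.derivative t = (φ.derivative (φ⁻¹ t))⁻¹ :=
  eq_inv_of_mul_eq_one_right (by rw [← derivative_mul, mul_inv_cancel, derivative_one])

section Topology

variable {Y : Type*} [TopologicalSpace Y] {F : Y → CircleDiff} {t : Y → UnitAddCircle}

theorem isInducing_toContinuousMap_derivative :
    IsInducing fun φ : CircleDiff => (φ.toContinuousMap, φ.derivative) := ⟨rfl⟩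

instance : SecondCountableTopology CircleDiff :=
  isInducing_toContinuousMap_derivative.secondCountableTopology

instance : TopologicalSpace.PseudoMetrizableSpace CircleDiff :=
  isInducing_toContinuousMap_derivative.pseudoMetrizableSpace

@[fun_prop] theorem continuous_apply (hF : Continuous F) (ht : Continuous t) :
    Continuous fun y => F y (t y) :=
  (continuous_eval (F := C(UnitAddCircle, UnitAddCircle))).comp
    ((isInducing_toContinuousMap_derivative.continuous.fst.comp hF).prodMk ht)

@[fun_prop] theorem continuous_derivative_apply (hF : Continuous F) (ht : Continuous t) :
    Continuous fun y => (F y).derivative (t y) :=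
  (continuous_eval (F := C(UnitAddCircle, ℝ))).comp
    ((isInducing_toContinuousMap_derivative.continuous.snd.comp hF).prodMk ht)

theorem continuous_of_uncurry (h₀ : Continuous fun p : Y × UnitAddCircle => F p.1 p.2)
    (h₁ : Continuous fun p : Y × UnitAddCircle => (F p.1).derivative p.2) : Continuous F :=
  continuous_induced_rng.mpr <| Continuous.prodMk
    (ContinuousMap.continuous_of_continuous_uncurry _ h₀)
    (ContinuousMap.continuous_of_continuous_uncurry _ h₁)

@[fun_prop] theorem continuous_rotate (hF : Continuous F) (ht : Continuous t) :
    Continuous fun y => (F y).rotate (t y) := by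
  refine continuous_of_uncurry ?_ ?_
  · simp only [rotate_apply]
    fun_prop
  · simp only [derivative_rotate]
    fun_prop

/-- Compactness of the circle makes the projection of the closed graph relation closed, so
preimages of closed sets are closed. -/
theorem continuous_inv_apply : Continuous fun p : CircleDiff × UnitAddCircle => p.1⁻¹ p.2 := by
  refine continuous_iff_isClosed.mpr fun C hC => ?_
  have hgraph : IsClosed {q : (CircleDiff × UnitAddCircle) × UnitAddCircle |
      q.1.1 q.2 = q.1.2 ∧ q.2 ∈ C} :=
    (isClosed_eq (by fun_prop) (by fun_prop)).inter (hC.preimage continuous_snd)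
  convert isClosedMap_fst_of_compactSpace _ hgraph using 1
  ext ⟨φ, y⟩
  constructor
  · exact fun h => ⟨((φ, y), φ⁻¹ y), ⟨φ.apply_inv_apply y, h⟩, rfl⟩
  · rintro ⟨⟨⟨φ', y'⟩, x⟩, ⟨hφx, hx⟩, ⟨⟩⟩
    simp only at hφx hx
    simpa [← hφx] using hx

instance : IsTopologicalGroup CircleDiff where
  continuous_mul := by
    refine continuous_of_uncurry ?_ ?_
    · simp only [mul_apply]
      fun_prop
    · simp only [derivative_mul]
      fun_prop
  continuous_inv := by
    refine continuous_of_uncurry continuous_inv_apply ?_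
    simp only [derivative_inv]
    exact (continuous_derivative_apply continuous_fst continuous_inv_apply).inv₀
      fun p => (derivative_pos _ _).ne'

end Topology

/-- The rotation `t ↦ t + θ`. -/
def rotation (θ : UnitAddCircle) : CircleDiff := (1 : CircleDiff).rotate θ

@[simp] theorem rotation_apply (θ t : UnitAddCircle) : rotation θ t = t + θ := by
  simp [rotation]

theorem rotation_mul (θ : UnitAddCircle) (φ : CircleDiff) : rotation θ * φ = φ.rotate θ := by
  ext t
  simp

@[fun_prop] theorem continuous_rotation : Continuous rotation := by
  unfold rotation
  fun_prop

theorem exists_lift_rotation (θ : UnitAddCircle) : ∃ c : ℝ, (rotation θ).lift = fun x => x + c := by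
  obtain ⟨c, rfl⟩ := QuotientAddGroup.mk_surjective θ
  obtain ⟨n, hn⟩ := (rotation c).exists_int_lift_eq_add (g := fun x => x + c) (by fun_prop)
    fun x => (rotation_apply _ _).trans (AddCircle.coe_add 1 x c).symm
  exact ⟨c + n, funext fun x => by rw [hn]; ring⟩

end CircleDiff

namespace CircleDiff

/-- The quantity `∫_𝕋 s(φ(τ)) φ'(τ)² dτ`, in terms of which the Jacobians of orbital measures are
expressed. -/
def pairing (s : C(UnitAddCircle, ℝ)) (φ : CircleDiff) : ℝ :=
  ∫ τ in (0 : ℝ)..1, s (φ (τ : UnitAddCircle)) * φ.derivative (τ : UnitAddCircle) ^ 2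

@[fun_prop] theorem continuous_coe_circle : Continuous fun x : ℝ => (x : UnitAddCircle) :=
  AddCircle.continuous_mk' (1 : ℝ)

@[fun_prop] theorem continuous_toFun_apply (φ : CircleDiff) : Continuous fun t => φ t :=
  φ.continuous_toFun

@[fun_prop] theorem continuous_pairing {Y : Type*} [TopologicalSpace Y]
    {s : Y → C(UnitAddCircle, ℝ)} {F : Y → CircleDiff} (hs : Continuous s) (hF : Continuous F) :
    Continuous fun y => pairing (s y) (F y) := by
  refine intervalIntegral.continuous_parametric_intervalIntegral_of_continuous' ?_ _ _
  change Continuous fun p : Y × ℝ => s p.1 (F p.1 p.2) * (F p.1).derivative p.2 ^ 2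
  fun_prop

theorem pairing_add (s r : C(UnitAddCircle, ℝ)) (φ : CircleDiff) :
    pairing (s + r) φ = pairing s φ + pairing r φ := by
  have hint (s : C(UnitAddCircle, ℝ)) : IntervalIntegrable
      (fun τ : ℝ => s (φ τ) * φ.derivative τ ^ 2) volume 0 1 :=
    Continuous.intervalIntegrable (by fun_prop) _ _
  rw [pairing, pairing, pairing, ← intervalIntegral.integral_add (hint s) (hint r)]
  simp only [ContinuousMap.add_apply, add_mul]

theorem pairing_smul (c : ℝ) (s : C(UnitAddCircle, ℝ)) (φ : CircleDiff) :
    pairing (c • s) φ = c * pairing s φ := by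
  rw [pairing, pairing, ← intervalIntegral.integral_const_mul]
  simp only [ContinuousMap.smul_apply, smul_eq_mul, mul_assoc]

theorem pairing_one (φ : CircleDiff) : pairing 1 φ = φ.energy := by
  simp only [pairing, energy, ContinuousMap.one_apply, one_mul, derivative_coe]

theorem energy_mul (ψ φ : CircleDiff) : (ψ * φ).energy = pairing (ψ.derivative ^ 2) φ := by
  rw [← pairing_one]
  simp only [pairing, derivative_mul, ContinuousMap.one_apply, one_mul, ContinuousMap.pow_apply,
    mul_pow]

@[fun_prop] theorem continuous_energy : Continuous energy := by
  rw [← funext pairing_one]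
  fun_prop

theorem energy_rotate (φ : CircleDiff) (θ : UnitAddCircle) : (φ.rotate θ).energy = φ.energy := by
  simp only [energy, ← derivative_coe, derivative_rotate]

theorem periodic_comp_coe {X : Type*} (w : UnitAddCircle → X) :
    Function.Periodic (fun x : ℝ => w x) 1 := fun x => by
  simp only [AddCircle.coe_add_period]

theorem integral_comp_mul_derivative (φ : CircleDiff) (w : C(UnitAddCircle, ℝ)) :
    ∫ τ in (0 : ℝ)..1, w (φ (τ : UnitAddCircle)) * φ.derivative (τ : UnitAddCircle)
      = ∫ x in (0 : ℝ)..1, w (x : UnitAddCircle) := by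
  have h := intervalIntegral.integral_comp_mul_deriv (a := 0) (b := 1) (f := φ.lift)
    (f' := fun τ => φ.derivative (τ : UnitAddCircle)) (g := fun x : ℝ => w (x : UnitAddCircle))
    (fun x _ => φ.hasDerivAt_lift x) (Continuous.continuousOn (by fun_prop)) (by fun_prop)
  simp only [Function.comp_apply, ← φ.coe_lift] at h
  have hone : φ.lift 1 = φ.lift 0 + 1 := by simpa using φ.isLift.map_add_one 0
  rw [h, hone, (periodic_comp_coe w).intervalIntegral_add_eq (φ.lift 0) 0, zero_add]

theorem pairing_eq_integral (s : C(UnitAddCircle, ℝ)) (φ : CircleDiff) :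
    pairing s φ
      = ∫ x in (0 : ℝ)..1, s (x : UnitAddCircle) * φ.derivative (φ⁻¹ (x : UnitAddCircle)) := by
  have h := φ.integral_comp_mul_derivative ⟨fun t => s t * φ.derivative (φ⁻¹ t),
    s.continuous.mul (φ.derivative.continuous.comp φ⁻¹.continuous_toFun)⟩
  simp only [ContinuousMap.coe_mk, inv_apply_apply] at h
  rw [← h, pairing]
  simp only [pow_two, mul_assoc]

theorem lintegral_comp_mul_derivative (φ : CircleDiff) (w : UnitAddCircle → ℝ≥0∞) :
    ∫⁻ t, ENNReal.ofReal (φ.derivative t) * w (φ t) = ∫⁻ t, w t := by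
  rw [← UnitAddCircle.lintegral_preimage (φ.lift 0) w,
    ← UnitAddCircle.lintegral_preimage 0 fun t => ENNReal.ofReal (φ.derivative t) * w (φ t)]
  have himg : φ.lift '' Ioc 0 (0 + 1) = Ioc (φ.lift 0) (φ.lift 0 + 1) := by
    rw [← φ.isLift.map_add_one]
    exact (φ.isLift.strictMono.orderIsoOfSurjective _ φ.isLift.surjective).image_Ioc 0 (0 + 1)
  rw [← himg, lintegral_image_eq_lintegral_abs_deriv_mul measurableSet_Ioc
    (fun x _ => (φ.hasDerivAt_lift x).hasDerivWithinAt) φ.isLift.strictMono.injective.injOn]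
  simp only [← φ.coe_lift, abs_of_pos (φ.derivative_pos _)]

theorem hasLogJacobian_volume (φ : CircleDiff) :
    HasLogJacobian volume φ fun t => Real.log (φ.derivative t) where
  measurable := φ.continuous_toFun.measurable
  measurable_exponent := φ.derivative.continuous.measurable.log
  map_eq := by
    ext A hA
    rw [map_expWeight_apply _ φ.continuous_toFun.measurable φ.derivative.continuous.measurable.log
      hA]
    simp only [Real.exp_log (φ.derivative_pos _)]
    rw [φ.lintegral_comp_mul_derivative, lintegral_indicator_one hA]

section Schwarzian

variable {ψ : CircleDiff}

theorem periodic_iteratedDeriv_lift (ψ : CircleDiff) {n : ℕ} (hn : n ≠ 0) :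
    Function.Periodic (iteratedDeriv n ψ.lift) 1 := fun x => by
  obtain ⟨n, rfl⟩ := Nat.exists_eq_succ_of_ne_zero hn
  have h := congrFun (iteratedDeriv_comp_add_const n (deriv ψ.lift) 1) x
  rw [iteratedDeriv_succ', ← h, funext ψ.periodic_deriv_lift]

theorem IsC3.exists_continuousMap_schwarzian (hψ : ψ.IsC3) :
    ∃ s : C(UnitAddCircle, ℝ), ∀ x : ℝ, schwarzian ψ.lift x = s x := by
  have hper : Function.Periodic (schwarzian ψ.lift) 1 := fun x => by
    simp only [schwarzian, ψ.periodic_iteratedDeriv_lift three_ne_zero x,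
      ψ.periodic_iteratedDeriv_lift two_ne_zero x, ψ.periodic_deriv_lift x]
  have hcont : Continuous (schwarzian ψ.lift) :=
    have h' := ψ.isLift.contDiff.continuous_deriv le_rfl
    have h'0 (x : ℝ) : deriv ψ.lift x ≠ 0 := (ψ.isLift.deriv_pos x).ne'
    ((hψ.continuous_iteratedDeriv 3 le_rfl).div h' h'0).sub
      (continuous_const.mul
        (((hψ.continuous_iteratedDeriv 2 (by norm_num)).div h' h'0).pow 2))
  exact ⟨⟨hper.lift, continuous_coinduced_dom.mpr hcont⟩, fun x => (hper.lift_coe x).symm⟩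

theorem orbitalExponent_eq (σ a : ℝ) {s : C(UnitAddCircle, ℝ)}
    (hs : ∀ x : ℝ, schwarzian ψ.lift x = s x) (φ : CircleDiff) :
    orbitalExponent σ a ψ φ
      = pairing s φ / σ ^ 2 + 2 * a / σ ^ 2 * ((ψ * φ).energy - φ.energy) := by
  have h : pairing (s + (2 * a) • (ψ.derivative ^ 2 + (-1 : ℝ) • 1)) φ
      = ∫ τ in (0 : ℝ)..1,
        (schwarzian ψ.lift (φ.lift τ) + 2 * a * (deriv ψ.lift (φ.lift τ) ^ 2 - 1))
          * deriv φ.lift τ ^ 2 := by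
    rw [pairing]
    refine intervalIntegral.integral_congr fun τ _ => ?_
    simp only [hs, ← derivative_coe, ← φ.coe_lift, ContinuousMap.add_apply,
      ContinuousMap.smul_apply, ContinuousMap.pow_apply, ContinuousMap.one_apply, smul_eq_mul]
    ring
  rw [orbitalExponent, ← h, pairing_add, pairing_smul, pairing_add, pairing_smul, pairing_one,
    energy_mul]
  ring

theorem IsC3.measurable_orbitalExponent (hψ : ψ.IsC3) (σ a : ℝ) :
    Measurable (orbitalExponent σ a ψ) := by
  obtain ⟨s, hs⟩ := hψ.exists_continuousMap_schwarzian
  rw [funext (orbitalExponent_eq σ a hs)]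
  exact Continuous.measurable (by fun_prop)

end Schwarzian

end CircleDiff

open CircleDiff

namespace IsOrbitalMeasure

variable {σ a a₀ : ℝ} {μ : Measure CircleDiff} {ψ : CircleDiff}

theorem hasLogJacobian (hμ : IsOrbitalMeasure σ a μ) (hψ : ψ.IsC3) :
    HasLogJacobian μ (ψ * ·) (orbitalExponent σ a ψ) where
  measurable := (continuous_const_mul ψ).measurable
  measurable_exponent := hψ.measurable_orbitalExponent σ a
  map_eq := by
    ext A hA
    have hpre := (continuous_const_mul ψ).measurable hA
    rw [Measure.map_apply (continuous_const_mul ψ).measurable hA, expWeight,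
      withDensity_apply _ hpre, ← hμ.change_of_variables ψ hψ _ hpre]
    exact congrArg μ (image_preimage_eq A (mul_left_surjective ψ))

theorem hasLogJacobian_orbitalFamily (hμ : IsOrbitalMeasure σ a₀ μ) (hψ : ψ.IsC3) :
    HasLogJacobian (orbitalFamily σ a₀ μ a) (ψ * ·) (orbitalExponent σ a ψ) := by
  obtain ⟨s, hs⟩ := hψ.exists_continuousMap_schwarzian
  have hexponent : orbitalExponent σ a ψ = orbitalExponent σ a₀ ψ +
      (fun φ => 2 * (a - a₀) / σ ^ 2 * φ.energy) ∘ (ψ * ·) -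
      fun φ => 2 * (a - a₀) / σ ^ 2 * φ.energy := by
    ext φ
    simp only [Pi.sub_apply, Pi.add_apply, Function.comp_apply, orbitalExponent_eq _ _ hs]
    ring
  rw [hexponent]
  exact (hμ.hasLogJacobian hψ).expWeight_measure (Continuous.measurable (by fun_prop))

theorem measurePreserving_rotate (hμ : IsOrbitalMeasure σ a₀ μ) (θ : UnitAddCircle) :
    MeasurePreserving (fun φ => φ.rotate θ) (orbitalFamily σ a₀ μ a)
      (orbitalFamily σ a₀ μ a) := by
  obtain ⟨c, hc⟩ := exists_lift_rotation θ
  have hC3 : (rotation θ).IsC3 := by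
    rw [IsC3, hc]
    fun_prop
  have hderiv : deriv (fun x : ℝ => x + c) = fun _ => 1 := by
    funext x
    simp
  have hschwarzian (x : ℝ) : schwarzian (rotation θ).lift x = (0 : C(UnitAddCircle, ℝ)) x := by
    simp [schwarzian, hc, iteratedDeriv_succ', hderiv]
  have hexponent : orbitalExponent σ a (rotation θ) = 0 := by
    ext φ
    rw [orbitalExponent_eq σ a hschwarzian, rotation_mul, energy_rotate]
    simp [pairing]
  have h : HasLogJacobian (orbitalFamily σ a₀ μ a) (rotation θ * ·) 0 :=
    hexponent ▸ hμ.hasLogJacobian_orbitalFamily hC3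
  simp only [rotation_mul] at h
  exact ⟨h.measurable, by simpa only [expWeight_zero] using h.map_eq⟩

end IsOrbitalMeasure

section Pinned

variable {t₀ : UnitAddCircle} {ν : Measure CircleDiff}

@[simp] theorem pin_apply (t₀ : UnitAddCircle) (φ : CircleDiff) (t : UnitAddCircle) :
    pin t₀ φ t = φ t - φ t₀ := (sub_eq_add_neg _ _).symm

theorem pin_rotate (t₀ : UnitAddCircle) (φ : CircleDiff) (θ : UnitAddCircle) :
    pin t₀ (φ.rotate θ) = pin t₀ φ := by
  ext t
  simp

theorem rotate_pin (t₀ : UnitAddCircle) (φ : CircleDiff) : (pin t₀ φ).rotate (φ t₀) = φ := by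
  ext t
  simp

theorem measurable_pin (t₀ : UnitAddCircle) : Measurable (pin t₀) := (continuous_pin t₀).measurable

theorem measurable_apply_pin (t₀ : UnitAddCircle) :
    Measurable fun φ : CircleDiff => (φ t₀, pin t₀ φ) :=
  (Continuous.measurable (by fun_prop)).prodMk (measurable_pin t₀)

instance [SFinite ν] : SFinite (pinned t₀ ν) := by
  unfold pinned
  infer_instance

theorem ae_pinned_apply_eq_zero (t₀ : UnitAddCircle) (ν : Measure CircleDiff) :
    ∀ᵐ φ ∂(pinned t₀ ν), φ t₀ = 0 := by
  rw [pinned, ae_map_iff (measurable_pin t₀).aemeasurable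
    (isClosed_eq (by fun_prop) continuous_const).measurableSet]
  exact ae_of_all _ fun φ => by simp

/-- The circle being compact, a whole orbit of rotations has a neighbourhood of finite measure. -/
theorem isLocallyFiniteMeasure_pinned (t₀ : UnitAddCircle) (ν : Measure CircleDiff)
    [IsLocallyFiniteMeasure ν] : IsLocallyFiniteMeasure (pinned t₀ ν) := by
  refine ⟨fun φ => ?_⟩
  have horbit : IsCompact (range fun θ => φ.rotate θ) :=
    isCompact_range (by fun_prop)
  obtain ⟨W, hW, hWopen, hWfinite⟩ := horbit.exists_open_superset_measure_lt_top ν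
  have hopen : IsOpen {χ : CircleDiff | ∀ θ, χ.rotate θ ∈ W} := by
    have hrotate : Continuous fun p : CircleDiff × UnitAddCircle => p.1.rotate p.2 := by fun_prop
    have hclosed := isClosedMap_fst_of_compactSpace _ (hWopen.preimage hrotate).isClosed_compl
    rw [← isClosed_compl_iff]
    convert hclosed using 1
    ext χ
    simp
  refine ⟨_, hopen.mem_nhds fun θ => hW ⟨θ, rfl⟩, ?_⟩
  rw [pinned, Measure.map_apply (measurable_pin t₀) hopen.measurableSet]
  exact (measure_mono fun χ hχ => rotate_pin t₀ χ ▸ hχ (χ t₀)).trans_lt hWfinite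

theorem map_apply_pin_eq_prod [SFinite ν]
    (hν : ∀ θ, MeasurePreserving (fun φ : CircleDiff => φ.rotate θ) ν ν) (t₀ : UnitAddCircle) :
    ν.map (fun φ => (φ t₀, pin t₀ φ)) = (volume : Measure UnitAddCircle).prod (pinned t₀ ν) := by
  refine Measure.ext_of_lintegral _ fun W hW => ?_
  have hpin := measurable_pin t₀
  have hrotate (θ : UnitAddCircle) :
      ∫⁻ φ, W (φ t₀, pin t₀ φ) ∂ν = ∫⁻ φ, W (φ t₀ + θ, pin t₀ φ) ∂ν :=
    ((hν θ).lintegral_comp (hW.comp (measurable_apply_pin t₀))).symm.trans <| by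
      simp only [Function.comp_apply, rotate_apply, pin_rotate]
  have hmeas : Measurable fun p : UnitAddCircle × CircleDiff => W (p.2 t₀ + p.1, pin t₀ p.2) :=
    hW.comp ((Continuous.measurable (by fun_prop)).prodMk (hpin.comp measurable_snd))
  calc ∫⁻ p, W p ∂ν.map (fun φ => (φ t₀, pin t₀ φ))
      = ∫⁻ φ, W (φ t₀, pin t₀ φ) ∂ν := lintegral_map hW (measurable_apply_pin t₀)
    _ = ∫⁻ θ : UnitAddCircle, ∫⁻ φ, W (φ t₀ + θ, pin t₀ φ) ∂ν := by
        simp only [← hrotate, lintegral_const, UnitAddCircle.measure_univ, mul_one]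
    _ = ∫⁻ φ, (∫⁻ θ : UnitAddCircle, W (φ t₀ + θ, pin t₀ φ)) ∂ν :=
        lintegral_lintegral_swap hmeas.aemeasurable
    _ = ∫⁻ φ, (∫⁻ θ : UnitAddCircle, W (θ, pin t₀ φ)) ∂ν :=
        lintegral_congr fun φ =>
          lintegral_add_left_eq_self (fun θ => W (θ, pin t₀ φ)) (φ t₀)
    _ = ∫⁻ φ, (∫⁻ θ : UnitAddCircle, W (θ, φ)) ∂pinned t₀ ν :=
        (lintegral_map hW.lintegral_prod_left' hpin).symm
    _ = ∫⁻ p, W p ∂(volume : Measure UnitAddCircle).prod (pinned t₀ ν) :=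
        (lintegral_prod_symm' W hW).symm

end Pinned

namespace CircleDiff

/-- The diffeomorphism `t ↦ ψ(t + θ) - ψ(θ)`. -/
def recenter (ψ : CircleDiff) (θ : UnitAddCircle) : CircleDiff :=
  rotation (-ψ θ) * ψ * rotation θ

@[simp] theorem recenter_apply (ψ : CircleDiff) (θ t : UnitAddCircle) :
    ψ.recenter θ t = ψ (t + θ) - ψ θ := by
  simp [recenter, sub_eq_add_neg]

@[fun_prop] theorem continuous_recenter {Y : Type*} [TopologicalSpace Y] {F : Y → CircleDiff}
    {θ : Y → UnitAddCircle} (hF : Continuous F) (hθ : Continuous θ) :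
    Continuous fun y => (F y).recenter (θ y) := by
  unfold recenter
  fun_prop

theorem recenter_zero {ψ : CircleDiff} (h : ψ 0 = 0) : ψ.recenter 0 = ψ := by
  ext t
  simp [h]

theorem recenter_mul_pin (ψ φ : CircleDiff) (t₀ : UnitAddCircle) :
    ψ.recenter (φ t₀) * pin t₀ φ = pin t₀ (ψ * φ) := by
  ext t
  simp

end CircleDiff

section Descent

variable {t₀ : UnitAddCircle} {ν : Measure CircleDiff} {ψ : CircleDiff} {E : CircleDiff → ℝ}

theorem HasLogJacobian.prod_pinned [SFinite ν] (h : HasLogJacobian ν (ψ * ·) E)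
    (hν : ∀ θ, MeasurePreserving (fun φ : CircleDiff => φ.rotate θ) ν ν) (t₀ : UnitAddCircle) :
    HasLogJacobian ((volume : Measure UnitAddCircle).prod (pinned t₀ ν))
      (fun p => (ψ p.1, ψ.recenter p.1 * p.2)) fun p => E (p.2.rotate p.1) := by
  rw [← map_apply_pin_eq_prod hν t₀]
  refine h.map_of_semiconj (measurable_apply_pin t₀) ?_ ?_ (fun φ => ?_) ?_
  · exact Continuous.measurable (by fun_prop)
  · exact h.measurable_exponent.comp (Continuous.measurable (by fun_prop))
  · simp only [recenter_mul_pin, mul_apply]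
  · ext φ
    simp only [Function.comp_apply, rotate_pin]

theorem HasLogJacobian.ae_map_pinned_recenter [SFinite ν] (h : HasLogJacobian ν (ψ * ·) E)
    (hν : ∀ θ, MeasurePreserving (fun φ : CircleDiff => φ.rotate θ) ν ν) (t₀ : UnitAddCircle)
    {A : Set CircleDiff} (hA : MeasurableSet A) :
    ∀ᵐ θ : UnitAddCircle, (expWeight (pinned t₀ ν) fun φ =>
      -Real.log (ψ.derivative θ) + E (φ.rotate θ)).map (ψ.recenter θ * ·) A = pinned t₀ ν A :=
  ψ.hasLogJacobian_volume.ae_map_expWeight_fiber_apply (R := fun θ => (ψ.recenter θ * ·))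
    (D := fun p => E (p.2.rotate p.1)) ψ⁻¹.continuous_toFun.measurable ψ.inv_apply_apply
    (h.prod_pinned hν t₀) hA

end Descent

/-- The diffeomorphisms `ψ n` act on `ν` with logarithmic Jacobians `E n`, converge to `f`, and
`E n` converges to `Λ` along convergent sequences with a limit pinned at `t₀`. -/
structure LogJacobianLimit (ν : Measure CircleDiff) (t₀ : UnitAddCircle) (ψ : ℕ → CircleDiff)
    (E : ℕ → CircleDiff → ℝ) (f : CircleDiff) (Λ : CircleDiff → ℝ) : Prop where
  hasLogJacobian : ∀ n, HasLogJacobian ν (ψ n * ·) (E n)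
  map_zero : f 0 = 0
  tendsto : Tendsto ψ atTop (𝓝 f)
  measurable : Measurable Λ
  tendsto_exponent : ∀ (F : ℕ → CircleDiff) (φ : CircleDiff), Tendsto F atTop (𝓝 φ) →
    φ t₀ = 0 → Tendsto (fun n => E n (F n)) atTop (𝓝 (Λ φ))

namespace LogJacobianLimit

variable {ν : Measure CircleDiff} {t₀ : UnitAddCircle} {ψ : ℕ → CircleDiff}
  {E : ℕ → CircleDiff → ℝ} {f : CircleDiff} {Λ : CircleDiff → ℝ}

theorem inv_map_zero (h : LogJacobianLimit ν t₀ ψ E f Λ) : f⁻¹ 0 = 0 := by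
  conv_lhs => rw [← h.map_zero, inv_apply_apply]

theorem inv (h : LogJacobianLimit ν t₀ ψ E f Λ) :
    LogJacobianLimit ν t₀ (fun n => (ψ n)⁻¹) (fun n => -(E n ∘ ((ψ n)⁻¹ * ·))) f⁻¹
      (-(Λ ∘ (f⁻¹ * ·))) where
  hasLogJacobian n := (h.hasLogJacobian n).inverse (continuous_const_mul _).measurable
    fun φ => inv_mul_cancel_left (ψ n) φ
  map_zero := h.inv_map_zero
  tendsto := h.tendsto.inv
  measurable := (h.measurable.comp (continuous_const_mul _).measurable).neg
  tendsto_exponent F φ hF hφ := by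
    have hpinned : (f⁻¹ * φ) t₀ = 0 := by rw [mul_apply, hφ, h.inv_map_zero]
    exact (h.tendsto_exponent _ _ (h.tendsto.inv.mul hF) hpinned).neg

theorem map_expWeight_pinned_le [SFinite ν] [(pinned t₀ ν).OuterRegular]
    (h : LogJacobianLimit ν t₀ ψ E f Λ)
    (hν : ∀ θ, MeasurePreserving (fun φ : CircleDiff => φ.rotate θ) ν ν) :
    (expWeight (pinned t₀ ν) fun φ => -Real.log (f.derivative 0) + Λ φ).map (f * ·)
      ≤ pinned t₀ ν := by
  refine measure_le_of_forall_isOpen fun U hU => ?_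
  obtain ⟨θ, hθ, hU_eq⟩ := exists_seq_tendsto_of_ae (x₀ := 0) fun n =>
    (h.hasLogJacobian n).ae_map_pinned_recenter hν t₀ hU.measurableSet
  have hpair := h.tendsto.prodMk_nhds hθ
  refine map_expWeight_apply_le_of_tendsto (fun n => (continuous_const_mul _).measurable)
    (continuous_const_mul f).measurable
    (fun n => ((h.hasLogJacobian n).measurable_exponent.comp
      (Continuous.measurable (by fun_prop))).const_add _)
    (h.measurable.const_add _) ?_ ?_ hU fun n => (hU_eq n).le
  · have hrecenter :=
      ((continuous_recenter continuous_fst continuous_snd).tendsto (f, 0)).comp hpair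
    rw [recenter_zero h.map_zero] at hrecenter
    exact ae_of_all _ fun φ => hrecenter.mul_const φ
  · filter_upwards [ae_pinned_apply_eq_zero t₀ ν] with φ hφ
    have hderivative := ((continuous_derivative_apply continuous_fst continuous_snd).tendsto
      (f, (0 : UnitAddCircle))).comp hpair
    have hrotate : Tendsto (fun n => φ.rotate (θ n)) atTop (𝓝 φ) := by
      have hφ0 : φ.rotate 0 = φ := by
        ext t
        simp
      have hcont : Continuous fun θ => φ.rotate θ := by fun_prop
      have hlim := (hcont.tendsto 0).comp hθ
      rwa [hφ0] at hlim
    exact (hderivative.log (f.derivative_pos 0).ne').neg.add (h.tendsto_exponent _ φ hrotate hφ)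

/-- The two inequalities between the measures come from the limit of `ψ n` and from that of
`(ψ n)⁻¹`. -/
theorem hasLogJacobian_pinned [SFinite ν] [(pinned t₀ ν).OuterRegular]
    (h : LogJacobianLimit ν t₀ ψ E f Λ)
    (hν : ∀ θ, MeasurePreserving (fun φ : CircleDiff => φ.rotate θ) ν ν) :
    HasLogJacobian (pinned t₀ ν) (f * ·) fun φ => -Real.log (f.derivative 0) + Λ φ where
  measurable := (continuous_const_mul f).measurable
  measurable_exponent := h.measurable.const_add _
  map_eq := by
    refine le_antisymm (h.map_expWeight_pinned_le hν) ?_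
    refine le_map_expWeight_of_map_inverse_le (continuous_const_mul f).measurable
      (continuous_const_mul f⁻¹).measurable (h.measurable.const_add _)
      (fun φ => mul_inv_cancel_left f φ) ?_
    convert h.inv.map_expWeight_pinned_le hν using 3
    ext φ
    simp only [Pi.neg_apply, Function.comp_apply, derivative_inv, h.inv_map_zero, Real.log_inv]
    ring

end LogJacobianLimit

/-- The space of continuous positive probability densities on the circle. -/
abbrev PosDensity : Type :=
  {h : C(UnitAddCircle, ℝ) // (∀ t, 0 < h t) ∧ ∫ x in (0 : ℝ)..1, h x = 1}

theorem hasDerivAt_integral_coe (h : C(UnitAddCircle, ℝ)) (x : ℝ) :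
    HasDerivAt (fun y : ℝ => ∫ τ in (0 : ℝ)..y, h τ) (h x) x :=
  (Continuous.integral_hasStrictDerivAt (f := fun τ : ℝ => h τ) (by fun_prop) 0 x).hasDerivAt

@[fun_prop] theorem continuous_integral_coe (h : C(UnitAddCircle, ℝ)) :
    Continuous fun y : ℝ => ∫ τ in (0 : ℝ)..y, h τ :=
  continuous_iff_continuousAt.mpr fun x => (hasDerivAt_integral_coe h x).continuousAt

theorem intervalIntegrable_coe (h : C(UnitAddCircle, ℝ)) (a b : ℝ) :
    IntervalIntegrable (fun x : ℝ => h x) volume a b :=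
  Continuous.intervalIntegrable (by fun_prop) a b

theorem integral_coe_add_one (h : C(UnitAddCircle, ℝ)) (x : ℝ) :
    ∫ τ in (0 : ℝ)..(x + 1), h τ = (∫ τ in (0 : ℝ)..x, h τ) + ∫ τ in (0 : ℝ)..1, h τ := by
  rw [← intervalIntegral.integral_add_adjacent_intervals (intervalIntegrable_coe h 0 x)
    (intervalIntegrable_coe h x (x + 1)), (periodic_comp_coe h).intervalIntegral_add_eq x 0,
    zero_add]

theorem isCircleDiffLift_integral (h : PosDensity) :
    IsCircleDiffLift fun y : ℝ => ∫ τ in (0 : ℝ)..y, h.1 τ := by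
  have hd : (deriv fun y : ℝ => ∫ τ in (0 : ℝ)..y, h.1 τ) = fun x : ℝ => h.1 x :=
    funext fun x => (hasDerivAt_integral_coe h.1 x).deriv
  refine ⟨?_, fun x => ?_, fun x => ?_⟩
  · rw [contDiff_one_iff_deriv, hd]
    exact ⟨fun x => (hasDerivAt_integral_coe h.1 x).differentiableAt, by fun_prop⟩
  · rw [integral_coe_add_one, h.2.2]
  · rw [hd]
    exact h.2.1 _

namespace CircleDiff

/-- The diffeomorphism fixing `0` with derivative `h`. -/
def ofDensity (h : PosDensity) : CircleDiff := ofLift _ (isCircleDiffLift_integral h)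

theorem ofDensity_coe (h : PosDensity) (x : ℝ) :
    ofDensity h x = ((∫ τ in (0 : ℝ)..x, h.1 τ : ℝ) : UnitAddCircle) := rfl

theorem ofDensity_zero (h : PosDensity) : ofDensity h 0 = 0 := by
  simpa using ofDensity_coe h 0

theorem derivative_ofDensity (h : PosDensity) : (ofDensity h).derivative = h.1 := by
  ext t
  obtain ⟨x, rfl⟩ := QuotientAddGroup.mk_surjective t
  exact (derivative_ofLift _ x).trans (hasDerivAt_integral_coe h.1 x).deriv

theorem continuous_ofDensity : Continuous ofDensity := by
  refine continuous_of_uncurry ?_ ?_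
  · have hq : IsOpenQuotientMap fun x : ℝ => (x : UnitAddCircle) :=
      QuotientAddGroup.isOpenQuotientMap_mk
    refine ((IsOpenQuotientMap.id (X := PosDensity)).prodMap hq).isQuotientMap.continuous_iff.mpr ?_
    refine continuous_coe_circle.comp
      (intervalIntegral.continuous_parametric_primitive_of_continuous
        (f := fun (h : PosDensity) (τ : ℝ) => h.1 τ) ?_)
    fun_prop
  · simp only [derivative_ofDensity]
    fun_prop

end CircleDiff

theorem schwarzian_eq_of_hasDerivAt {g u v : ℝ → ℝ} {c p x : ℝ} (hc : c ≠ 0) (hux : u x ≠ 0)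
    (hg : ∀ᶠ y in 𝓝 x, HasDerivAt g (c * (u y ^ 2)⁻¹) y) (hu : ∀ᶠ y in 𝓝 x, HasDerivAt u (v y) y)
    (hv : HasDerivAt v p x) : schwarzian g x = -2 * p / u x := by
  have hne : ∀ᶠ y in 𝓝 x, u y ≠ 0 := hu.self_of_nhds.continuousAt.eventually_ne hux
  have hderiv : deriv g =ᶠ[𝓝 x] fun y => c * (u y ^ 2)⁻¹ := hg.mono fun y hy => hy.deriv
  have hderiv₂ : deriv (deriv g) =ᶠ[𝓝 x] fun y => -2 * c * v y * (u y ^ 3)⁻¹ := by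
    filter_upwards [hderiv.eventuallyEq_nhds, hu, hne] with y hy hyu hy0
    refine hy.deriv_eq.trans ((((hyu.pow 2).inv (pow_ne_zero 2 hy0)).const_mul c).deriv.trans ?_)
    push_cast
    simp only [Pi.pow_apply]
    field_simp
  have hderiv₃ : HasDerivAt (fun y => -2 * c * v y * (u y ^ 3)⁻¹)
      (-2 * c * p * (u x ^ 3)⁻¹ + 6 * c * v x ^ 2 * (u x ^ 4)⁻¹) x := by
    refine ((hv.const_mul (-2 * c)).mul
      ((hu.self_of_nhds.pow 3).inv (pow_ne_zero 3 hux))).congr_deriv ?_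
    push_cast
    simp only [Pi.pow_apply, Pi.inv_apply]
    field_simp
    ring
  simp only [schwarzian, iteratedDeriv_succ, iteratedDeriv_zero]
  rw [hderiv₂.deriv_eq, hderiv₃.deriv, hderiv₂.self_of_nhds, hderiv.self_of_nhds]
  field_simp
  ring

/-- The space of positive continuous functions on the circle. -/
abbrev PosFun : Type := {u : C(UnitAddCircle, ℝ) // ∀ t, 0 < u t}

namespace PosFun

/-- The reciprocal of a positive function. -/
def recip (u : PosFun) : C(UnitAddCircle, ℝ) :=
  ⟨fun t => (u.1 t)⁻¹, u.1.continuous.inv₀ fun t => (u.2 t).ne'⟩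

theorem recip_apply (u : PosFun) (t : UnitAddCircle) : u.recip t = (u.1 t)⁻¹ := rfl

theorem recip_pos (u : PosFun) (t : UnitAddCircle) : 0 < u.recip t := inv_pos.mpr (u.2 t)

@[fun_prop] theorem continuous_recip : Continuous recip := by
  refine ContinuousMap.continuous_of_continuous_uncurry _ ?_
  change Continuous fun p : PosFun × UnitAddCircle => (p.1.1 p.2)⁻¹
  exact Continuous.inv₀ (by fun_prop) fun p => (p.1.2 p.2).ne'

/-- The total mass of `u⁻²`, which normalises `u⁻²` to a probability density. -/
def mass (u : PosFun) : ℝ := ∫ x in (0 : ℝ)..1, u.recip x ^ 2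

theorem mass_pos (u : PosFun) : 0 < u.mass :=
  intervalIntegral.intervalIntegral_pos_of_pos (Continuous.intervalIntegrable (by fun_prop) _ _)
    (fun _ => pow_pos (u.recip_pos _) 2) one_pos

theorem continuous_mass : Continuous mass :=
  intervalIntegral.continuous_parametric_intervalIntegral_of_continuous'
    (f := fun (u : PosFun) (x : ℝ) => u.recip x ^ 2) (by fun_prop) _ _

/-- The probability density proportional to `u⁻²`. -/
def density (u : PosFun) : PosDensity :=
  ⟨u.mass⁻¹ • u.recip ^ 2, fun t => mul_pos (inv_pos.mpr u.mass_pos) (pow_pos (u.recip_pos t) 2), by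
    simp only [ContinuousMap.smul_apply, ContinuousMap.pow_apply, smul_eq_mul,
      intervalIntegral.integral_const_mul]
    exact inv_mul_cancel₀ u.mass_pos.ne'⟩

theorem continuous_density : Continuous density :=
  (continuous_mass.inv₀ fun u => u.mass_pos.ne').smul (continuous_recip.pow 2) |>.subtype_mk _

/-- The diffeomorphism fixing `0` with derivative proportional to `u⁻²`, i.e. the projectivised
solution of Hill's equation with solution `u`. -/
def diffeo (u : PosFun) : CircleDiff := ofDensity u.density

theorem continuous_diffeo : Continuous diffeo := continuous_ofDensity.comp continuous_density

theorem diffeo_zero (u : PosFun) : u.diffeo 0 = 0 := ofDensity_zero _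

theorem derivative_diffeo (u : PosFun) (t : UnitAddCircle) :
    u.diffeo.derivative t = u.mass⁻¹ * (u.1 t ^ 2)⁻¹ := by
  simp [diffeo, derivative_ofDensity, density, recip_apply]

theorem hasDerivAt_lift_diffeo (u : PosFun) (x : ℝ) :
    HasDerivAt u.diffeo.lift (u.mass⁻¹ * (u.1 x ^ 2)⁻¹) x :=
  u.derivative_diffeo x ▸ u.diffeo.hasDerivAt_lift x

variable (u : PosFun) {v p : C(UnitAddCircle, ℝ)}

theorem isC3_diffeo (hu : ∀ x : ℝ, HasDerivAt (fun y : ℝ => u.1 y) (v x) x)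
    (hv : ∀ x : ℝ, HasDerivAt (fun y : ℝ => v y) (p x) x) : u.diffeo.IsC3 := by
  have hv₁ : ContDiff ℝ 1 fun y : ℝ => v y := by
    rw [contDiff_one_iff_deriv, funext fun x => (hv x).deriv]
    exact ⟨fun x => (hv x).differentiableAt, by fun_prop⟩
  have hu₂ : ContDiff ℝ (1 + 1) fun y : ℝ => u.1 y := by
    rw [contDiff_succ_iff_deriv, funext fun x => (hu x).deriv]
    exact ⟨fun x => (hu x).differentiableAt, by simp, hv₁⟩
  rw [IsC3, show (3 : WithTop ℕ∞) = 1 + 1 + 1 by norm_num, contDiff_succ_iff_deriv,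
    funext fun x => (u.hasDerivAt_lift_diffeo x).deriv]
  exact ⟨fun x => (u.hasDerivAt_lift_diffeo x).differentiableAt, by simp,
    contDiff_const.mul ((hu₂.pow 2).inv fun x => pow_ne_zero 2 (u.2 _).ne')⟩

theorem schwarzian_diffeo (hu : ∀ x : ℝ, HasDerivAt (fun y : ℝ => u.1 y) (v x) x)
    (hv : ∀ x : ℝ, HasDerivAt (fun y : ℝ => v y) (p x) x) (x : ℝ) :
    schwarzian u.diffeo.lift x = ((-2 : ℝ) • (p * u.recip)) x := by
  rw [schwarzian_eq_of_hasDerivAt (inv_ne_zero u.mass_pos.ne') (u.2 _).ne'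
    (Eventually.of_forall u.hasDerivAt_lift_diffeo) (Eventually.of_forall hu) (hv x)]
  simp only [ContinuousMap.smul_apply, ContinuousMap.mul_apply, recip_apply, smul_eq_mul]
  ring

end PosFun

/-- The primitive vanishing at `0` of a function of mean zero on the circle. -/
def circlePrimitive (p : C(UnitAddCircle, ℝ)) (hp : ∫ x in (0 : ℝ)..1, p x = 0) :
    C(UnitAddCircle, ℝ) where
  toFun := Function.Periodic.lift (c := (1 : ℝ)) (f := fun y : ℝ => ∫ x in (0 : ℝ)..y, p x)
    fun y => by beta_reduce; rw [integral_coe_add_one, hp, add_zero]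
  continuous_toFun := continuous_coinduced_dom.mpr (continuous_integral_coe p)

theorem circlePrimitive_neg {p : C(UnitAddCircle, ℝ)} (hp : ∫ x in (0 : ℝ)..1, p x = 0)
    (heven : ∀ t, p (-t) = p t) (t : UnitAddCircle) :
    circlePrimitive p hp (-t) = -circlePrimitive p hp t := by
  obtain ⟨y, rfl⟩ := QuotientAddGroup.mk_surjective t
  have h : ∫ x in (0 : ℝ)..(-y), p x = -∫ x in (0 : ℝ)..y, p x := by
    have hneg := intervalIntegral.integral_comp_neg (a := 0) (b := y) fun x : ℝ => p x
    simp only [AddCircle.coe_neg, heven, neg_zero] at hneg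
    rw [hneg, intervalIntegral.integral_symm]
  exact h

theorem coe_one_sub (x : ℝ) : ((1 - x : ℝ) : UnitAddCircle) = -(x : UnitAddCircle) := by
  rw [← AddCircle.coe_neg, show (1 - x : ℝ) = -x + 1 by ring, AddCircle.coe_add_period]

theorem integral_eq_zero_of_odd {v : C(UnitAddCircle, ℝ)} (hodd : ∀ t, v (-t) = -v t) :
    ∫ x in (0 : ℝ)..1, v x = 0 := by
  have h := intervalIntegral.integral_comp_sub_left (a := 0) (b := 1) (fun x : ℝ => v x) 1
  simp only [coe_one_sub, hodd, sub_self, sub_zero, intervalIntegral.integral_neg] at h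
  linarith

section Bump

/-- The half-width of the `n`-th bump. -/
def bumpWidth (n : ℕ) : ℝ := 1 / ((n : ℝ) + 1)

theorem bumpWidth_pos (n : ℕ) : 0 < bumpWidth n := Nat.one_div_pos_of_nat

theorem tendsto_bumpWidth : Tendsto bumpWidth atTop (𝓝 0) :=
  tendsto_one_div_add_atTop_nhds_zero_nat

/-- A tent function at `0` on the circle, a bump before normalisation. -/
def tent (n : ℕ) : C(UnitAddCircle, ℝ) := ⟨fun t => max 0 (bumpWidth n - ‖t‖), by fun_prop⟩

theorem tent_apply (n : ℕ) (t : UnitAddCircle) : tent n t = max 0 (bumpWidth n - ‖t‖) := rfl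

theorem integral_tent_pos (n : ℕ) : 0 < ∫ x in (0 : ℝ)..1, tent n x :=
  intervalIntegral.integral_pos one_pos (by fun_prop) (fun x _ => le_max_left _ _)
    ⟨0, by simp, by simp [tent_apply, bumpWidth_pos]⟩

/-- A continuous approximation of the Dirac mass at `0`. -/
def bump (n : ℕ) : C(UnitAddCircle, ℝ) := (∫ x in (0 : ℝ)..1, tent n x)⁻¹ • tent n

theorem bump_nonneg (n : ℕ) (t : UnitAddCircle) : 0 ≤ bump n t :=
  mul_nonneg (inv_pos.mpr (integral_tent_pos n)).le (le_max_left _ _)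

theorem bump_neg (n : ℕ) (t : UnitAddCircle) : bump n (-t) = bump n t := by
  simp [bump, tent_apply]

theorem bump_eq_zero {n : ℕ} {t : UnitAddCircle} (h : bumpWidth n ≤ ‖t‖) : bump n t = 0 := by
  simp [bump, tent_apply, h]

theorem integral_bump (n : ℕ) : ∫ x in (0 : ℝ)..1, bump n x = 1 := by
  simp only [bump, ContinuousMap.smul_apply, smul_eq_mul, intervalIntegral.integral_const_mul]
  exact inv_mul_cancel₀ (integral_tent_pos n).ne'

theorem dist_integral_bump_mul_le {n : ℕ} {w : C(UnitAddCircle, ℝ)} {c ε : ℝ}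
    (hw : ∀ t, ‖t‖ < bumpWidth n → dist (w t) c ≤ ε) :
    dist (∫ x in (0 : ℝ)..1, bump n x * w x) c ≤ ε := by
  have hbound (t : UnitAddCircle) : ‖bump n t * (w t - c)‖ ≤ bump n t * ε := by
    rw [norm_mul, Real.norm_of_nonneg (bump_nonneg n t)]
    rcases le_or_gt (bumpWidth n) ‖t‖ with ht | ht
    · simp [bump_eq_zero ht]
    · exact mul_le_mul_of_nonneg_left (hw t ht) (bump_nonneg n t)
  have hsub : (∫ x in (0 : ℝ)..1, bump n x * w x) - c
      = ∫ x in (0 : ℝ)..1, bump n x * (w x - c) := by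
    simp only [mul_sub]
    rw [intervalIntegral.integral_sub (Continuous.intervalIntegrable (by fun_prop) _ _)
      (Continuous.intervalIntegrable (by fun_prop) _ _), intervalIntegral.integral_mul_const,
      integral_bump, one_mul]
  calc dist (∫ x in (0 : ℝ)..1, bump n x * w x) c
      = ‖∫ x in (0 : ℝ)..1, bump n x * (w x - c)‖ := by rw [dist_eq_norm, hsub]
    _ ≤ ∫ x in (0 : ℝ)..1, bump n x * ε :=
        intervalIntegral.norm_integral_le_of_norm_le zero_le_one
          (Eventually.of_forall fun x _ => hbound x)
          (Continuous.intervalIntegrable (by fun_prop) _ _)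
    _ = ε := by rw [intervalIntegral.integral_mul_const, integral_bump, one_mul]

theorem tendsto_integral_bump_mul {ι : Type*} {l : Filter ι} {k : ι → ℕ} (hk : Tendsto k l atTop)
    {w : ι → C(UnitAddCircle, ℝ)} {w₀ : C(UnitAddCircle, ℝ)} (hw : Tendsto w l (𝓝 w₀)) :
    Tendsto (fun n => ∫ x in (0 : ℝ)..1, bump (k n) x * w n x) l (𝓝 (w₀ 0)) := by
  rw [Metric.tendsto_nhds]
  intro ε hε
  obtain ⟨δ, hδ, hw₀⟩ := Metric.continuous_iff.mp w₀.continuous 0 (ε / 4) (by positivity)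
  filter_upwards [Metric.tendsto_nhds.mp hw (ε / 4) (by positivity),
    (tendsto_bumpWidth.comp hk).eventually_lt_const hδ] with n hn hwidth
  refine (dist_integral_bump_mul_le (ε := ε / 2) fun t ht => ?_).trans_lt (half_lt_self hε)
  have hdist : dist (w n t) (w₀ t) < ε / 4 := (ContinuousMap.dist_apply_le_dist t).trans_lt hn
  have hdist₀ : dist (w₀ t) (w₀ 0) < ε / 4 := hw₀ t (by simpa using ht.trans hwidth)
  linarith [dist_triangle (w n t) (w₀ t) (w₀ 0)]

theorem tendsto_pairing_mul_bump {ι : Type*} {l : Filter ι} {k : ι → ℕ} (hk : Tendsto k l atTop)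
    {B : ι → C(UnitAddCircle, ℝ)} {B₀ : C(UnitAddCircle, ℝ)} (hB : Tendsto B l (𝓝 B₀))
    {F : ι → CircleDiff} {φ : CircleDiff} (hF : Tendsto F l (𝓝 φ)) {t₀ : UnitAddCircle}
    (hφ : φ t₀ = 0) :
    Tendsto (fun n => pairing (B n * bump (k n)) (F n)) l (𝓝 (B₀ 0 * φ.derivative t₀)) := by
  have hcont : Continuous fun χ : CircleDiff => χ.derivative.comp χ⁻¹.toContinuousMap :=
    ContinuousMap.continuous_of_continuous_uncurry _
      (continuous_derivative_apply continuous_fst continuous_inv_apply)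
  have hderivative : φ.derivative t₀ = φ.derivative.comp φ⁻¹.toContinuousMap 0 := by
    rw [← inv_apply_apply φ t₀, hφ]
    rfl
  rw [hderivative]
  refine (tendsto_integral_bump_mul hk (hB.mul ((hcont.tendsto φ).comp hF))).congr fun n => ?_
  rw [pairing_eq_integral]
  refine intervalIntegral.integral_congr fun x _ => ?_
  change bump (k n) x * (B n x * (F n).derivative ((F n)⁻¹ x))
    = B n x * bump (k n) x * (F n).derivative ((F n)⁻¹ x)
  ring

/-- The primitive of the `n`-th bump, normalised so as to tend to `0` on `(0, 1)`. -/
def bumpPrimitive (n : ℕ) (y : ℝ) : ℝ := (∫ x in (0 : ℝ)..y, bump n x) - 1 / 2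

@[fun_prop] theorem continuous_bumpPrimitive (n : ℕ) : Continuous (bumpPrimitive n) :=
  (continuous_integral_coe (bump n)).sub continuous_const

theorem bumpPrimitive_half (n : ℕ) : bumpPrimitive n (1 / 2) = 0 := by
  have hadd := intervalIntegral.integral_add_adjacent_intervals
    (intervalIntegrable_coe (bump n) 0 (1 / 2)) (intervalIntegrable_coe (bump n) (1 / 2) 1)
  have hreflect := intervalIntegral.integral_comp_sub_left (a := 0) (b := 1 / 2)
    (fun x : ℝ => bump n x) 1
  simp only [coe_one_sub, bump_neg] at hreflect
  rw [integral_bump] at hadd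
  norm_num [bumpPrimitive] at hreflect hadd ⊢
  linarith

theorem le_norm_coe {ε x : ℝ} (h₁ : ε ≤ x) (h₂ : x ≤ 1 - ε) : ε ≤ ‖(x : UnitAddCircle)‖ := by
  rw [UnitAddCircle.norm_eq, le_abs]
  rcases le_or_gt (round x) 0 with h | h
  · left
    have : ((round x : ℤ) : ℝ) ≤ 0 := by exact_mod_cast h
    linarith
  · right
    have : (1 : ℝ) ≤ ((round x : ℤ) : ℝ) := by exact_mod_cast h
    linarith

theorem bumpPrimitive_eq_zero {n : ℕ} {y : ℝ} (hn : bumpWidth n ≤ 1 / 2)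
    (hy : y ∈ Icc (bumpWidth n) (1 - bumpWidth n)) : bumpPrimitive n y = 0 := by
  have hzero : ∫ x in (1 / 2 : ℝ)..y, bump n x = ∫ _ in (1 / 2 : ℝ)..y, (0 : ℝ) :=
    intervalIntegral.integral_congr fun _ hx => bump_eq_zero <|
      le_norm_coe ((le_min hn hy.1).trans hx.1) (hx.2.trans (max_le (by linarith) hy.2))
  rw [← bumpPrimitive_half n, bumpPrimitive, bumpPrimitive,
    ← intervalIntegral.integral_add_adjacent_intervals (intervalIntegrable_coe (bump n) 0 (1 / 2))
      (intervalIntegrable_coe (bump n) (1 / 2) y), hzero, intervalIntegral.integral_zero, add_zero]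

theorem tendsto_bumpPrimitive {y : ℝ} (hy : y ∈ Ioo (0 : ℝ) 1) :
    Tendsto (fun n => bumpPrimitive n y) atTop (𝓝 0) := by
  refine tendsto_const_nhds.congr' ?_
  filter_upwards [tendsto_bumpWidth.eventually_lt_const one_half_pos,
    tendsto_bumpWidth.eventually_lt_const hy.1,
    tendsto_bumpWidth.eventually_lt_const (sub_pos.mpr hy.2)] with n hhalf hleft hright
  exact (bumpPrimitive_eq_zero hhalf.le ⟨hleft.le, by linarith⟩).symm

theorem abs_bumpPrimitive_le (n : ℕ) {y : ℝ} (hy : y ∈ Icc (0 : ℝ) 1) :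
    |bumpPrimitive n y| ≤ 1 := by
  have hleft : 0 ≤ ∫ x in (0 : ℝ)..y, bump n x :=
    intervalIntegral.integral_nonneg hy.1 fun x _ => bump_nonneg n _
  have hright : 0 ≤ ∫ x in y..1, bump n x :=
    intervalIntegral.integral_nonneg hy.2 fun x _ => bump_nonneg n _
  have hadd := intervalIntegral.integral_add_adjacent_intervals
    (intervalIntegrable_coe (bump n) 0 y) (intervalIntegrable_coe (bump n) y 1)
  rw [integral_bump] at hadd
  rw [bumpPrimitive, abs_le]
  constructor <;> linarith

theorem tendsto_integral_abs_bumpPrimitive :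
    Tendsto (fun n => ∫ y in (0 : ℝ)..1, |bumpPrimitive n y|) atTop (𝓝 0) := by
  have h := intervalIntegral.tendsto_integral_filter_of_dominated_convergence (μ := volume)
    (a := 0) (b := 1) (l := atTop) (F := fun n y => |bumpPrimitive n y|) (f := fun _ => 0)
    (fun _ => 1)
    (Eventually.of_forall fun n => Continuous.aestronglyMeasurable (by fun_prop))
    (Eventually.of_forall fun n => Eventually.of_forall fun y hy => by
      rw [uIoc_of_le zero_le_one] at hy
      rw [Real.norm_eq_abs, abs_abs]
      exact abs_bumpPrimitive_le n (Ioc_subset_Icc_self hy))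
    intervalIntegrable_const ?_
  · simpa using h
  · filter_upwards [Measure.ae_ne volume (1 : ℝ)] with y hy hmem
    rw [uIoc_of_le zero_le_one] at hmem
    simpa using (tendsto_bumpPrimitive ⟨hmem.1, lt_of_le_of_ne hmem.2 hy⟩).abs

end Bump

/-- `C x = cos (α x)` and `S x = sin (α x) / α` for `α² = a`, with `C > 0` on `[-1/2, 1/2]`. -/
structure IsTrigPair (a : ℝ) (C S : ℝ → ℝ) : Prop where
  hasDerivAt_cos : ∀ x, HasDerivAt C (-a * S x) x
  hasDerivAt_sin : ∀ x, HasDerivAt S (C x) x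
  cos_neg : ∀ x, C (-x) = C x
  sin_neg : ∀ x, S (-x) = -S x
  sq_add_sq : ∀ x, C x ^ 2 + a * S x ^ 2 = 1
  cos_pos : ∀ x ∈ Icc (-(1 / 2) : ℝ) (1 / 2), 0 < C x

theorem exists_mem_Ico_coe_eq (t : UnitAddCircle) :
    ∃ x ∈ Ico (0 : ℝ) 1, (x : UnitAddCircle) = t :=
  ⟨AddCircle.equivIco 1 0 t, by simpa using (AddCircle.equivIco 1 0 t).2, AddCircle.coe_equivIco⟩

namespace IsTrigPair

variable {a : ℝ} {C S : ℝ → ℝ}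

theorem continuous_cos (h : IsTrigPair a C S) : Continuous C :=
  continuous_iff_continuousAt.mpr fun x => (h.hasDerivAt_cos x).continuousAt

theorem continuous_sin (h : IsTrigPair a C S) : Continuous S :=
  continuous_iff_continuousAt.mpr fun x => (h.hasDerivAt_sin x).continuousAt

theorem sin_zero (h : IsTrigPair a C S) : S 0 = 0 := by
  have hodd := h.sin_neg 0
  rw [neg_zero] at hodd
  linarith

theorem sin_half_pos (h : IsTrigPair a C S) : 0 < S (1 / 2) := by
  have hmono : StrictMonoOn S (Icc (-(1 / 2)) (1 / 2)) := by
    refine strictMonoOn_of_deriv_pos (convex_Icc _ _) h.continuous_sin.continuousOn fun x hx => ?_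
    rw [(h.hasDerivAt_sin x).deriv]
    exact h.cos_pos x (interior_subset hx)
  have hlt := hmono (a := 0) (b := 1 / 2) (by norm_num) (by norm_num) (by norm_num)
  rwa [h.sin_zero] at hlt

theorem cos_half_pos (h : IsTrigPair a C S) : 0 < C (1 / 2) := h.cos_pos _ (by norm_num)

/-- The periodic extension of `C (x - 1/2)`, `x ∈ [0, 1]`, with a kink at `0`. -/
def kink (h : IsTrigPair a C S) : C(UnitAddCircle, ℝ) where
  toFun := AddCircle.liftIco 1 0 fun x => C (x - 1 / 2)
  continuous_toFun := AddCircle.liftIco_zero_continuous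
    (by rw [← h.cos_neg]; congr 1; norm_num)
    (h.continuous_cos.comp (continuous_id.sub continuous_const)).continuousOn

theorem kink_coe (h : IsTrigPair a C S) {x : ℝ} (hx : x ∈ Icc (0 : ℝ) 1) :
    h.kink x = C (x - 1 / 2) := by
  have hIco {y : ℝ} (hy : y ∈ Ico (0 : ℝ) 1) : h.kink y = C (y - 1 / 2) :=
    AddCircle.liftIco_zero_coe_apply (f := fun x => C (x - 1 / 2)) hy
  rcases hx.2.lt_or_eq with hlt | rfl
  · exact hIco ⟨hx.1, hlt⟩
  · have hperiod := AddCircle.coe_add_period (1 : ℝ) 0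
    rw [zero_add] at hperiod
    rw [hperiod, hIco (by simp), ← h.cos_neg]
    norm_num

theorem kink_pos (h : IsTrigPair a C S) (t : UnitAddCircle) : 0 < h.kink t := by
  obtain ⟨x, hx, rfl⟩ := exists_mem_Ico_coe_eq t
  rw [h.kink_coe (Ico_subset_Icc_self hx)]
  exact h.cos_pos _ ⟨by linarith [hx.1], by linarith [hx.2]⟩

theorem kink_neg (h : IsTrigPair a C S) (t : UnitAddCircle) : h.kink (-t) = h.kink t := by
  obtain ⟨x, hx, rfl⟩ := exists_mem_Ico_coe_eq t
  rw [← coe_one_sub, h.kink_coe ⟨by linarith [hx.2], by linarith [hx.1]⟩,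
    h.kink_coe (Ico_subset_Icc_self hx), ← h.cos_neg]
  ring_nf

theorem kink_zero (h : IsTrigPair a C S) : h.kink 0 = C (1 / 2) := by
  have hzero := h.kink_coe (x := 0) (by simp)
  rwa [AddCircle.coe_zero, zero_sub, h.cos_neg] at hzero

theorem integral_kink (h : IsTrigPair a C S) {y : ℝ} (hy : y ∈ Icc (0 : ℝ) 1) :
    ∫ x in (0 : ℝ)..y, h.kink x = S (y - 1 / 2) + S (1 / 2) := by
  have hderiv (x : ℝ) (hx : x ∈ uIcc 0 y) :
      HasDerivAt (fun x => S (x - 1 / 2)) (h.kink x) x := by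
    rw [uIcc_of_le hy.1] at hx
    rw [h.kink_coe ⟨hx.1, hx.2.trans hy.2⟩]
    exact (h.hasDerivAt_sin (x - 1 / 2)).comp_sub_const x (1 / 2)
  rw [intervalIntegral.integral_eq_sub_of_hasDerivAt hderiv (intervalIntegrable_coe _ _ _),
    zero_sub, h.sin_neg, sub_neg_eq_add]

/-- A continuous approximation of the second derivative of `kink`, which has a Dirac mass
at `0`. -/
def curvature (h : IsTrigPair a C S) (n : ℕ) : C(UnitAddCircle, ℝ) :=
  (-a) • h.kink + (2 * a * S (1 / 2)) • bump n

theorem curvature_neg (h : IsTrigPair a C S) (n : ℕ) (t : UnitAddCircle) :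
    h.curvature n (-t) = h.curvature n t := by
  simp [curvature, h.kink_neg, bump_neg]

theorem integral_curvature (h : IsTrigPair a C S) (n : ℕ) {y : ℝ} (hy : y ∈ Icc (0 : ℝ) 1) :
    ∫ x in (0 : ℝ)..y, h.curvature n x
      = -a * S (y - 1 / 2) + 2 * a * S (1 / 2) * bumpPrimitive n y := by
  simp only [curvature, ContinuousMap.add_apply, ContinuousMap.smul_apply, smul_eq_mul]
  rw [intervalIntegral.integral_add (Continuous.intervalIntegrable (by fun_prop) _ _)
      (Continuous.intervalIntegrable (by fun_prop) _ _),
    intervalIntegral.integral_const_mul, intervalIntegral.integral_const_mul, h.integral_kink hy,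
    bumpPrimitive]
  ring

theorem integral_curvature_one (h : IsTrigPair a C S) (n : ℕ) :
    ∫ x in (0 : ℝ)..1, h.curvature n x = 0 := by
  rw [h.integral_curvature n (by simp), bumpPrimitive, integral_bump]
  norm_num
  ring

/-- The slope of the smoothed kink. -/
def slope (h : IsTrigPair a C S) (n : ℕ) : C(UnitAddCircle, ℝ) :=
  circlePrimitive (h.curvature n) (h.integral_curvature_one n)

theorem integral_slope_one (h : IsTrigPair a C S) (n : ℕ) :
    ∫ x in (0 : ℝ)..1, h.slope n x = 0 :=
  integral_eq_zero_of_odd (circlePrimitive_neg _ (h.curvature_neg n))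

/-- A `C²` approximation of `kink`. -/
def smoothKink (h : IsTrigPair a C S) (n : ℕ) : C(UnitAddCircle, ℝ) :=
  ContinuousMap.const _ (C (1 / 2)) + circlePrimitive (h.slope n) (h.integral_slope_one n)

theorem hasDerivAt_slope (h : IsTrigPair a C S) (n : ℕ) (x : ℝ) :
    HasDerivAt (fun y : ℝ => h.slope n y) (h.curvature n x) x :=
  hasDerivAt_integral_coe (h.curvature n) x

theorem hasDerivAt_smoothKink (h : IsTrigPair a C S) (n : ℕ) (x : ℝ) :
    HasDerivAt (fun y : ℝ => h.smoothKink n y) (h.slope n x) x :=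
  (hasDerivAt_integral_coe (h.slope n) x).const_add _

theorem smoothKink_sub_kink (h : IsTrigPair a C S) (n : ℕ) {x : ℝ} (hx : x ∈ Icc (0 : ℝ) 1) :
    h.smoothKink n x - h.kink x
      = 2 * a * S (1 / 2) * ∫ y in (0 : ℝ)..x, bumpPrimitive n y := by
  have hderiv (y : ℝ) : HasDerivAt (fun y => C (y - 1 / 2)) (-a * S (y - 1 / 2)) y :=
    (h.hasDerivAt_cos (y - 1 / 2)).comp_sub_const y (1 / 2)
  have hsin : IntervalIntegrable (fun y => -a * S (y - 1 / 2)) volume 0 x :=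
    (continuous_const.mul (h.continuous_sin.comp
      (continuous_id.sub continuous_const))).intervalIntegrable _ _
  have hslope : ∫ y in (0 : ℝ)..x, h.slope n y
      = ∫ y in (0 : ℝ)..x, (-a * S (y - 1 / 2) + 2 * a * S (1 / 2) * bumpPrimitive n y) := by
    refine intervalIntegral.integral_congr fun y hy => h.integral_curvature n ?_
    rw [uIcc_of_le hx.1] at hy
    exact ⟨hy.1, hy.2.trans hx.2⟩
  have hsmooth : h.smoothKink n x = C (1 / 2) + ∫ y in (0 : ℝ)..x, h.slope n y := rfl
  rw [hsmooth, hslope, intervalIntegral.integral_add hsin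
      (Continuous.intervalIntegrable (by fun_prop) _ _),
    intervalIntegral.integral_eq_sub_of_hasDerivAt (fun y _ => hderiv y) hsin,
    intervalIntegral.integral_const_mul, h.kink_coe hx, zero_sub, h.cos_neg]
  ring

theorem norm_smoothKink_sub_kink_le (h : IsTrigPair a C S) (n : ℕ) :
    ‖h.smoothKink n - h.kink‖
      ≤ |2 * a * S (1 / 2)| * ∫ y in (0 : ℝ)..1, |bumpPrimitive n y| := by
  have hnonneg : 0 ≤ ∫ y in (0 : ℝ)..1, |bumpPrimitive n y| :=
    intervalIntegral.integral_nonneg zero_le_one fun _ _ => abs_nonneg _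
  refine (ContinuousMap.norm_le _ (by positivity)).mpr fun t => ?_
  obtain ⟨x, hx, rfl⟩ := exists_mem_Ico_coe_eq t
  rw [ContinuousMap.sub_apply, h.smoothKink_sub_kink n (Ico_subset_Icc_self hx), norm_mul,
    Real.norm_eq_abs]
  gcongr
  exact (intervalIntegral.norm_integral_le_integral_norm hx.1).trans <|
    intervalIntegral.integral_mono_interval le_rfl hx.1 hx.2.le
      (Eventually.of_forall fun _ => abs_nonneg _) (Continuous.intervalIntegrable (by fun_prop) _ _)

theorem tendsto_smoothKink (h : IsTrigPair a C S) : Tendsto h.smoothKink atTop (𝓝 h.kink) := by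
  rw [tendsto_iff_norm_sub_tendsto_zero]
  refine squeeze_zero (fun n => norm_nonneg _) h.norm_smoothKink_sub_kink_le ?_
  simpa using tendsto_integral_abs_bumpPrimitive.const_mul |2 * a * S (1 / 2)|

/-- `kink` as a positive function. -/
def kinkPos (h : IsTrigPair a C S) : PosFun := ⟨h.kink, h.kink_pos⟩

theorem exists_tendsto_smoothKink_pos (h : IsTrigPair a C S) :
    ∃ (k : ℕ → ℕ) (u : ℕ → PosFun), Tendsto k atTop atTop ∧ Tendsto u atTop (𝓝 h.kinkPos) ∧
      ∀ n, (u n).1 = h.smoothKink (k n) := by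
  have hopen : IsOpen {u : C(UnitAddCircle, ℝ) | MapsTo u univ (Ioi 0)} :=
    ContinuousMap.isOpen_setOfPred_mapsTo isCompact_univ isOpen_Ioi
  obtain ⟨N, hN⟩ := eventually_atTop.mp <|
    h.tendsto_smoothKink.eventually (hopen.mem_nhds fun t _ => h.kink_pos t)
  have hshift := tendsto_add_atTop_nat N
  exact ⟨(· + N), fun n => ⟨h.smoothKink (n + N), fun t => hN _ (Nat.le_add_left _ _) (mem_univ t)⟩,
    hshift, tendsto_subtype_rng.mpr (h.tendsto_smoothKink.comp hshift), fun _ => rfl⟩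

/-- The circle diffeomorphism with constant Schwarzian `2 a` away from `0`. -/
def diffeo (h : IsTrigPair a C S) : CircleDiff := h.kinkPos.diffeo

theorem diffeo_zero (h : IsTrigPair a C S) : h.diffeo 0 = 0 := h.kinkPos.diffeo_zero

theorem tendsto_pairing_curvature_mul_recip (h : IsTrigPair a C S) {ι : Type*} {l : Filter ι}
    {k : ι → ℕ} (hk : Tendsto k l atTop) {u : ι → PosFun} (hu : Tendsto u l (𝓝 h.kinkPos))
    {F : ι → CircleDiff} {φ : CircleDiff} (hF : Tendsto F l (𝓝 φ)) {t₀ : UnitAddCircle}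
    (hφ : φ t₀ = 0) :
    Tendsto (fun n => pairing (h.curvature (k n) * (u n).recip) (F n)) l
      (𝓝 (-a * φ.energy + 2 * a * S (1 / 2) / C (1 / 2) * φ.derivative t₀)) := by
  have hrecip : Tendsto (fun n => (u n).recip) l (𝓝 h.kinkPos.recip) :=
    (PosFun.continuous_recip.tendsto _).comp hu
  have hkink : Tendsto (fun n => pairing (h.kink * (u n).recip) (F n)) l (𝓝 φ.energy) := by
    have hone : h.kink * h.kinkPos.recip = 1 := by
      ext t
      exact mul_inv_cancel₀ (h.kink_pos t).ne'
    rw [← pairing_one, ← hone]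
    exact ((continuous_pairing continuous_fst continuous_snd).tendsto (_, φ)).comp
      ((hrecip.const_mul h.kink).prodMk_nhds hF)
  have hbump := tendsto_pairing_mul_bump hk hrecip hF hφ
  rw [PosFun.recip_apply, kinkPos, h.kink_zero] at hbump
  have hsplit (n : ι) : h.curvature (k n) * (u n).recip
      = (-a) • (h.kink * (u n).recip)
        + (2 * a * S (1 / 2)) • ((u n).recip * bump (k n)) := by
    rw [curvature, add_mul, smul_mul_assoc, smul_mul_assoc, mul_comm (bump _)]
  simp only [hsplit, pairing_add, pairing_smul]
  convert (hkink.const_mul (-a)).add (hbump.const_mul (2 * a * S (1 / 2))) using 2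
  ring

theorem exists_logJacobianLimit (h : IsTrigPair a C S) {σ a₀ : ℝ} {μ : Measure CircleDiff}
    (hμ : IsOrbitalMeasure σ a₀ μ) (t₀ : UnitAddCircle) :
    ∃ ψ : ℕ → CircleDiff, LogJacobianLimit (orbitalFamily σ a₀ μ 0) t₀ ψ
      (fun n => orbitalExponent σ 0 (ψ n)) h.diffeo fun φ =>
        (2 * a * φ.energy - 4 * a * S (1 / 2) / C (1 / 2) * φ.derivative t₀) / σ ^ 2 := by
  obtain ⟨k, u, hk, hu, hu_eq⟩ := h.exists_tendsto_smoothKink_pos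
  have hslope (n : ℕ) (x : ℝ) : HasDerivAt (fun y : ℝ => (u n).1 y) (h.slope (k n) x) x :=
    hu_eq n ▸ h.hasDerivAt_smoothKink (k n) x
  have hschwarzian (n : ℕ) := (u n).schwarzian_diffeo (hslope n) (h.hasDerivAt_slope (k n))
  refine ⟨fun n => (u n).diffeo, fun n => hμ.hasLogJacobian_orbitalFamily
    ((u n).isC3_diffeo (hslope n) (h.hasDerivAt_slope (k n))), h.diffeo_zero,
    (PosFun.continuous_diffeo.tendsto _).comp hu, Continuous.measurable (by fun_prop),
    fun F φ hF hφ => ?_⟩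
  have hlim :=
    ((h.tendsto_pairing_curvature_mul_recip hk hu hF hφ).const_mul (-2)).div_const (σ ^ 2)
  convert hlim using 2 with n
  · rw [orbitalExponent_eq σ 0 (hschwarzian n), pairing_smul]
    ring
  · ring

end IsTrigPair

theorem IsTrigPair.contDiff {a : ℝ} {C S : ℝ → ℝ} (h : IsTrigPair a C S) (n : ℕ) :
    ContDiff ℝ n C ∧ ContDiff ℝ n S := by
  induction n with
  | zero => exact ⟨contDiff_zero.mpr h.continuous_cos, contDiff_zero.mpr h.continuous_sin⟩
  | succ k ih =>
    push_cast
    rw [contDiff_succ_iff_deriv, contDiff_succ_iff_deriv,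
      funext fun x => (h.hasDerivAt_cos x).deriv, funext fun x => (h.hasDerivAt_sin x).deriv]
    exact ⟨⟨fun x => (h.hasDerivAt_cos x).differentiableAt, by simp, contDiff_const.mul ih.2⟩,
      ⟨fun x => (h.hasDerivAt_sin x).differentiableAt, by simp, ih.1⟩⟩

/-- The map `f_α` in terms of `C = cos (α ·)` and `S = sin (α ·) / α`. -/
def tanMap (C S : ℝ → ℝ) (t : ℝ) : ℝ :=
  1 / 2 * (C (1 / 2) / S (1 / 2) * (S (t - 1 / 2) / C (t - 1 / 2)) + 1)

namespace IsTrigPair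

variable {a : ℝ} {C S : ℝ → ℝ}

theorem tanMap_zero (h : IsTrigPair a C S) : tanMap C S 0 = 0 := by
  have hsin := h.sin_half_pos.ne'
  have hcos := h.cos_half_pos.ne'
  rw [tanMap, zero_sub, h.sin_neg, h.cos_neg]
  field_simp
  ring

theorem tanMap_one (h : IsTrigPair a C S) : tanMap C S 1 = 1 := by
  have hsin := h.sin_half_pos.ne'
  have hcos := h.cos_half_pos.ne'
  rw [tanMap, show (1 : ℝ) - 1 / 2 = 1 / 2 by norm_num]
  field_simp
  ring

theorem hasDerivAt_tanMap (h : IsTrigPair a C S) {t : ℝ} (ht : C (t - 1 / 2) ≠ 0) :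
    HasDerivAt (tanMap C S) (C (1 / 2) / (2 * S (1 / 2)) * (C (t - 1 / 2) ^ 2)⁻¹) t := by
  have hcos : HasDerivAt (fun y => C (y - 1 / 2)) (-a * S (t - 1 / 2)) t :=
    (h.hasDerivAt_cos (t - 1 / 2)).comp_sub_const t (1 / 2)
  have hsin : HasDerivAt (fun y => S (y - 1 / 2)) (C (t - 1 / 2)) t :=
    (h.hasDerivAt_sin (t - 1 / 2)).comp_sub_const t (1 / 2)
  have hwronskian : C (t - 1 / 2) * C (t - 1 / 2) - S (t - 1 / 2) * (-a * S (t - 1 / 2)) = 1 := by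
    linear_combination h.sq_add_sq (t - 1 / 2)
  refine ((((hsin.div hcos ht).const_mul (C (1 / 2) / S (1 / 2))).add_const 1).const_mul
    (1 / 2)).congr_deriv ?_
  have hhalf := h.sin_half_pos.ne'
  rw [hwronskian]
  field_simp

theorem cos_sub_half_pos (h : IsTrigPair a C S) {t : ℝ} (ht : t ∈ Icc (0 : ℝ) 1) :
    0 < C (t - 1 / 2) := h.cos_pos _ ⟨by linarith [ht.1], by linarith [ht.2]⟩

theorem isIntervalDiff3_tanMap (h : IsTrigPair a C S) : IsIntervalDiff3 (tanMap C S) where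
  contDiffOn := by
    have hsub : ContDiff ℝ 3 fun t : ℝ => t - 1 / 2 := contDiff_id.sub contDiff_const
    have hcos : ContDiff ℝ 3 fun t => C (t - 1 / 2) := (h.contDiff 3).1.comp hsub
    have hsin : ContDiff ℝ 3 fun t => S (t - 1 / 2) := (h.contDiff 3).2.comp hsub
    exact contDiffOn_const.mul ((contDiffOn_const.mul (hsin.contDiffOn.div hcos.contDiffOn
      fun t ht => (h.cos_sub_half_pos ht).ne')).add contDiffOn_const)
  map_zero := h.tanMap_zero
  map_one := h.tanMap_one
  deriv_pos t ht := by
    have hpos := h.cos_sub_half_pos ht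
    have hcos := h.cos_half_pos
    have hsin := h.sin_half_pos
    rw [(h.hasDerivAt_tanMap hpos.ne').hasDerivWithinAt.derivWithin
      (uniqueDiffOn_Icc zero_lt_one t ht)]
    positivity

theorem schwarzian_tanMap (h : IsTrigPair a C S) {t : ℝ} (ht : t ∈ Icc (0 : ℝ) 1) :
    schwarzian (tanMap C S) t = 2 * a := by
  have hpos := h.cos_sub_half_pos ht
  have hconst : C (1 / 2) / (2 * S (1 / 2)) ≠ 0 :=
    (div_pos h.cos_half_pos (mul_pos two_pos h.sin_half_pos)).ne'
  have hcos (y : ℝ) : HasDerivAt (fun y => C (y - 1 / 2)) (-a * S (y - 1 / 2)) y :=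
    (h.hasDerivAt_cos (y - 1 / 2)).comp_sub_const y (1 / 2)
  have hsin : HasDerivAt (fun y => -a * S (y - 1 / 2)) (-a * C (t - 1 / 2)) t :=
    ((h.hasDerivAt_sin (t - 1 / 2)).comp_sub_const t (1 / 2)).const_mul (-a)
  rw [schwarzian_eq_of_hasDerivAt (u := fun y => C (y - 1 / 2)) hconst hpos.ne'
    (((hcos t).continuousAt.eventually_ne hpos.ne').mono fun y hy => h.hasDerivAt_tanMap hy)
    (Eventually.of_forall hcos) hsin, div_eq_iff hpos.ne']
  ring

theorem integral_inv_kink_sq (h : IsTrigPair a C S) {t : ℝ} (ht : t ∈ Icc (0 : ℝ) 1) :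
    C (1 / 2) / (2 * S (1 / 2)) * ∫ x in (0 : ℝ)..t, (h.kink x ^ 2)⁻¹ = tanMap C S t := by
  have hderiv (x : ℝ) (hx : x ∈ uIcc 0 t) : HasDerivAt (tanMap C S)
      (C (1 / 2) / (2 * S (1 / 2)) * (h.kink x ^ 2)⁻¹) x := by
    rw [uIcc_of_le ht.1] at hx
    have hxIcc : x ∈ Icc (0 : ℝ) 1 := ⟨hx.1, hx.2.trans ht.2⟩
    rw [h.kink_coe hxIcc]
    exact h.hasDerivAt_tanMap (h.cos_sub_half_pos hxIcc).ne'
  have hcont : Continuous fun x : ℝ => (h.kink x ^ 2)⁻¹ :=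
    Continuous.inv₀ (by fun_prop) fun x => pow_ne_zero 2 (h.kink_pos _).ne'
  rw [← intervalIntegral.integral_const_mul,
    intervalIntegral.integral_eq_sub_of_hasDerivAt hderiv
      (Continuous.intervalIntegrable (by fun_prop) _ _),
    h.tanMap_zero, sub_zero]

theorem inv_mass_kinkPos (h : IsTrigPair a C S) :
    h.kinkPos.mass⁻¹ = C (1 / 2) / (2 * S (1 / 2)) := by
  have hone := h.integral_inv_kink_sq (t := 1) (by simp)
  rw [h.tanMap_one] at hone
  rw [inv_eq_iff_eq_inv, PosFun.mass]
  simp only [PosFun.recip_apply, inv_pow]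
  exact eq_inv_of_mul_eq_one_right hone

theorem diffeo_coe (h : IsTrigPair a C S) {t : ℝ} (ht : t ∈ Icc (0 : ℝ) 1) :
    h.diffeo t = (tanMap C S t : UnitAddCircle) := by
  rw [← h.integral_inv_kink_sq ht, ← h.inv_mass_kinkPos, ← intervalIntegral.integral_const_mul,
    diffeo, PosFun.diffeo, ofDensity_coe]
  simp only [PosFun.density, ContinuousMap.smul_apply, ContinuousMap.pow_apply, PosFun.recip_apply,
    smul_eq_mul, inv_pow]
  rfl

theorem derivative_diffeo_zero (h : IsTrigPair a C S) :
    h.diffeo.derivative 0 = 1 / (2 * S (1 / 2) * C (1 / 2)) := by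
  have hsin := h.sin_half_pos.ne'
  have hcos := h.cos_half_pos.ne'
  rw [diffeo, PosFun.derivative_diffeo, h.inv_mass_kinkPos, kinkPos, h.kink_zero]
  field_simp

theorem one_id : IsTrigPair 0 (fun _ => 1) (fun x => x) where
  hasDerivAt_cos x := by simpa using hasDerivAt_const x (1 : ℝ)
  hasDerivAt_sin x := hasDerivAt_id x
  cos_neg _ := rfl
  sin_neg _ := rfl
  sq_add_sq _ := by simp
  cos_pos _ _ := one_pos

theorem cos_sin {r : ℝ} (hr : r ≠ 0) (hπ : r ^ 2 < Real.pi ^ 2) :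
    IsTrigPair (r ^ 2) (fun x => Real.cos (r * x)) (fun x => Real.sin (r * x) / r) where
  hasDerivAt_cos x := by
    refine (((hasDerivAt_id x).const_mul r).cos).congr_deriv ?_
    simp only [id]
    field_simp
  hasDerivAt_sin x := by
    refine ((((hasDerivAt_id x).const_mul r).sin).div_const r).congr_deriv ?_
    simp only [id]
    field_simp
  cos_neg x := by simp
  sin_neg x := by simp [neg_div]
  sq_add_sq x := by
    rw [div_pow, mul_div_cancel₀ _ (pow_ne_zero 2 hr)]
    exact Real.cos_sq_add_sin_sq _
  cos_pos x hx := by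
    have hrπ : |r| < Real.pi := abs_lt_of_sq_lt_sq hπ Real.pi_pos.le
    have hx : |x| ≤ 1 / 2 := abs_le.mpr hx
    have hrx : |r * x| < Real.pi / 2 := by
      rw [abs_mul]
      nlinarith [abs_nonneg r, abs_nonneg x]
    exact Real.cos_pos_of_mem_Ioo (abs_lt.mp hrx)

theorem cosh_sinh {r : ℝ} (hr : r ≠ 0) :
    IsTrigPair (-r ^ 2) (fun x => Real.cosh (r * x)) (fun x => Real.sinh (r * x) / r) where
  hasDerivAt_cos x := by
    refine (((hasDerivAt_id x).const_mul r).cosh).congr_deriv ?_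
    simp only [id]
    field_simp
  hasDerivAt_sin x := by
    refine ((((hasDerivAt_id x).const_mul r).sinh).div_const r).congr_deriv ?_
    simp only [id]
    field_simp
  cos_neg x := by simp
  sin_neg x := by simp [neg_div]
  sq_add_sq x := by
    rw [div_pow, neg_mul, mul_div_cancel₀ _ (pow_ne_zero 2 hr), ← sub_eq_add_neg]
    exact Real.cosh_sq_sub_sinh_sq _
  cos_pos x _ := Real.cosh_pos _

end IsTrigPair

/-- The trigonometric pair attached to the parameter `α`; the equation for `sin` does not
determine `S` if `α = 0`. -/
structure IsComplexTrigPair (α : ℂ) (C S : ℝ → ℝ) : Prop extends IsTrigPair (α ^ 2).re C S where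
  cos_eq : ∀ x : ℝ, Complex.cos (α * x) = C x
  sin_eq : ∀ x : ℝ, Complex.sin (α * x) = α * S x
  sin_of_eq_zero : α = 0 → ∀ x, S x = x

namespace IsComplexTrigPair

theorem zero : IsComplexTrigPair 0 (fun _ => 1) (fun x => x) where
  toIsTrigPair := by simpa using IsTrigPair.one_id
  cos_eq := by simp
  sin_eq := by simp
  sin_of_eq_zero _ _ := rfl

theorem ofReal {r : ℝ} (hr : r ≠ 0) (hπ : r ^ 2 < Real.pi ^ 2) :
    IsComplexTrigPair r (fun x => Real.cos (r * x)) (fun x => Real.sin (r * x) / r) where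
  toIsTrigPair := by
    convert IsTrigPair.cos_sin hr hπ
    norm_cast
  cos_eq x := by push_cast; rfl
  sin_eq x := by
    have : (r : ℂ) ≠ 0 := by exact_mod_cast hr
    push_cast
    field_simp
  sin_of_eq_zero h := absurd (by exact_mod_cast h) hr

theorem ofReal_mul_I {r : ℝ} (hr : r ≠ 0) :
    IsComplexTrigPair (r * Complex.I) (fun x => Real.cosh (r * x))
      (fun x => Real.sinh (r * x) / r) where
  toIsTrigPair := by
    convert IsTrigPair.cosh_sinh hr
    rw [mul_pow, Complex.I_sq]
    norm_cast
    simp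
  cos_eq x := by
    rw [mul_right_comm, Complex.cos_mul_I]
    push_cast
    rfl
  sin_eq x := by
    have : (r : ℂ) ≠ 0 := by exact_mod_cast hr
    rw [mul_right_comm, Complex.sin_mul_I]
    push_cast
    field_simp
  sin_of_eq_zero h := absurd (by simpa using h) hr

variable {α : ℂ} {C S : ℝ → ℝ}

theorem exists_of_sq_im_eq_zero (hα : (α ^ 2).im = 0) (hπ : (α ^ 2).re < Real.pi ^ 2) :
    ∃ C S : ℝ → ℝ, IsComplexTrigPair α C S := by
  rcases eq_or_ne α 0 with rfl | hα0
  · exact ⟨_, _, zero⟩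
  have hre_or_im : α.re = 0 ∨ α.im = 0 := by
    rw [← mul_eq_zero]
    simp only [pow_two, Complex.mul_im] at hα
    linarith
  rcases hre_or_im with hre | him
  · obtain ⟨r, rfl⟩ : ∃ r : ℝ, α = r * Complex.I :=
      ⟨α.im, by apply Complex.ext <;> simp [hre]⟩
    exact ⟨_, _, ofReal_mul_I fun hr => hα0 (by simp [hr])⟩
  · obtain ⟨r, rfl⟩ : ∃ r : ℝ, α = r := ⟨α.re, by apply Complex.ext <;> simp [him]⟩
    exact ⟨_, _, ofReal (by exact_mod_cast hα0) (by exact_mod_cast hπ)⟩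

theorem cos_of_eq_zero (h : IsComplexTrigPair α C S) (hα : α = 0) (x : ℝ) : C x = 1 := by
  have hcos := h.cos_eq x
  rw [hα, zero_mul, Complex.cos_zero] at hcos
  exact_mod_cast hcos.symm

theorem sin_half_eq (h : IsComplexTrigPair α C S) : Complex.sin (α / 2) = α * S (1 / 2) := by
  rw [← h.sin_eq]
  push_cast
  ring_nf

theorem tan_eq (h : IsComplexTrigPair α C S) (x : ℝ) : Complex.tan (α * x) = α * S x / C x := by
  rw [Complex.tan, h.cos_eq, h.sin_eq]

theorem fAlpha_eq_tanMap (h : IsComplexTrigPair α C S) : fAlpha α = tanMap C S := by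
  ext t
  by_cases hα : α = 0
  · rw [fAlpha, if_pos hα, tanMap]
    simp only [h.sin_of_eq_zero hα, h.cos_of_eq_zero hα]
    ring
  · have hhalf : Complex.tan (α / 2) = α * S (1 / 2) / C (1 / 2) := by
      rw [← h.tan_eq]
      push_cast
      ring_nf
    have hshift : Complex.tan (α * (t - 1 / 2)) = α * S (t - 1 / 2) / C (t - 1 / 2) := by
      rw [← h.tan_eq]
      push_cast
      rfl
    have hsin : (S (1 / 2) : ℂ) ≠ 0 := by exact_mod_cast h.sin_half_pos.ne'
    rw [fAlpha, if_neg hα, hhalf, hshift, ← Complex.ofReal_re (tanMap C S t), tanMap]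
    congr 1
    push_cast
    field_simp

theorem alphaDivSin_eq (h : IsComplexTrigPair α C S) :
    alphaDivSin α = h.diffeo.derivative 0 := by
  rw [h.derivative_diffeo_zero]
  by_cases hα : α = 0
  · rw [alphaDivSin, if_pos hα, h.sin_of_eq_zero hα, h.cos_of_eq_zero hα]
    norm_num
  · have hdouble : Complex.sin α = 2 * (α * S (1 / 2)) * C (1 / 2) := by
      rw [← h.cos_eq, ← h.sin_eq, ← Complex.sin_two_mul]
      push_cast
      ring_nf
    have hreal : α / Complex.sin α = ((1 / (2 * S (1 / 2) * C (1 / 2)) : ℝ) : ℂ) := by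
      rw [hdouble]
      push_cast
      field_simp
    rw [alphaDivSin, if_neg hα, hreal, Complex.ofReal_re]

theorem defectCoeff_eq (h : IsComplexTrigPair α C S) :
    defectCoeff α = 8 * (α ^ 2).re * S (1 / 2) ^ 2 := by
  have hreal : 8 * (α * (S (1 / 2) : ℂ)) ^ 2 = ((8 * S (1 / 2) ^ 2 : ℝ) : ℂ) * α ^ 2 := by
    push_cast
    ring
  rw [defectCoeff, h.sin_half_eq, hreal, Complex.re_ofReal_mul]
  ring

end IsComplexTrigPair

theorem pinned_orbitalFamily_eq_expWeight (σ a₀ a : ℝ) (μ : Measure CircleDiff)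
    (t₀ : UnitAddCircle) :
    pinned t₀ (orbitalFamily σ a₀ μ a)
      = expWeight (pinned t₀ (orbitalFamily σ a₀ μ 0)) fun φ => 2 * a / σ ^ 2 * φ.energy := by
  have henergy : Measurable CircleDiff.energy := continuous_energy.measurable
  have hpin : (fun φ : CircleDiff => 2 * a / σ ^ 2 * φ.energy) ∘ pin t₀
      = fun φ => 2 * a / σ ^ 2 * φ.energy := by
    ext φ
    simp only [Function.comp_apply, pin, energy_rotate]
  have hexponent : (fun φ : CircleDiff => 2 * (a - a₀) / σ ^ 2 * φ.energy)
      = (fun φ => 2 * (0 - a₀) / σ ^ 2 * φ.energy) + fun φ => 2 * a / σ ^ 2 * φ.energy := by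
    ext φ
    simp only [Pi.add_apply]
    ring
  have hweight : orbitalFamily σ a₀ μ a
      = expWeight (orbitalFamily σ a₀ μ 0) fun φ => 2 * a / σ ^ 2 * φ.energy :=
    (congrArg (expWeight μ) hexponent).trans
      (expWeight_expWeight μ (henergy.const_mul _) (henergy.const_mul _)).symm
  have hmap := map_expWeight_comp (orbitalFamily σ a₀ μ 0) (measurable_pin t₀)
    (henergy.const_mul (2 * a / σ ^ 2))
  rw [hpin, ← hweight] at hmap
  exact hmap

theorem IsOrbitalMeasure.isLocallyFiniteMeasure_orbitalFamily {σ a₀ : ℝ} {μ : Measure CircleDiff}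
    (hμ : IsOrbitalMeasure σ a₀ μ) (a : ℝ) :
    IsLocallyFiniteMeasure (orbitalFamily σ a₀ μ a) :=
  have := hμ.locallyFinite
  IsLocallyFiniteMeasure.withDensity_ofReal
    (Real.continuous_exp.comp (continuous_const.mul continuous_energy))

namespace IsTrigPair

variable {a : ℝ} {C S : ℝ → ℝ}

theorem map_pinned_orbitalFamily (h : IsTrigPair a C S) {σ a₀ : ℝ} {μ : Measure CircleDiff}
    (hμ : IsOrbitalMeasure σ a₀ μ) (t₀ : UnitAddCircle) :
    (pinned t₀ (orbitalFamily σ a₀ μ a)).map (fun φ => h.diffeo.comp φ)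
      = ENNReal.ofReal (h.diffeo.derivative 0) •
        expWeight (pinned t₀ (orbitalFamily σ a₀ μ 0))
          fun φ => 8 * a * S (1 / 2) ^ 2 / σ ^ 2 * φ.derivative t₀ := by
  let ν := orbitalFamily σ a₀ μ 0
  let defect (φ : CircleDiff) : ℝ := 8 * a * S (1 / 2) ^ 2 / σ ^ 2 * φ.derivative t₀
  let logSlope : ℝ := Real.log (h.diffeo.derivative 0)
  have hdefect : Measurable defect := Continuous.measurable (by fun_prop)
  have : IsLocallyFiniteMeasure ν := hμ.isLocallyFiniteMeasure_orbitalFamily 0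
  have := isLocallyFiniteMeasure_pinned t₀ ν
  obtain ⟨ψ, hψ⟩ := h.exists_logJacobianLimit hμ t₀
  have hjacobian := hψ.hasLogJacobian_pinned hμ.measurePreserving_rotate
  have hexponent : (fun φ : CircleDiff => 2 * a / σ ^ 2 * φ.energy) =ᵐ[pinned t₀ ν]
      (fun φ => -logSlope + (2 * a * φ.energy - 4 * a * S (1 / 2) / C (1 / 2) * φ.derivative t₀)
        / σ ^ 2) + (fun φ => logSlope + defect φ) ∘ (h.diffeo * ·) := by
    filter_upwards [ae_pinned_apply_eq_zero t₀ ν] with φ hφ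
    simp only [defect, Pi.add_apply, Function.comp_apply, derivative_mul, hφ,
      h.derivative_diffeo_zero]
    field_simp
    ring
  rw [pinned_orbitalFamily_eq_expWeight, expWeight_congr_ae hexponent]
  calc _ = expWeight (pinned t₀ ν) (fun φ => logSlope + defect φ) :=
        hjacobian.map_expWeight_add_comp (hdefect.const_add _)
    _ = _ := by
        rw [expWeight_const_add _ _ hdefect, Real.exp_log (h.diffeo.derivative_pos 0)]

end IsTrigPair

theorem mainTheorem7 (σ : ℝ) (hσ : 0 < σ)
    (a₀ : ℝ) (μ : Measure CircleDiff) (hμ : IsOrbitalMeasure σ a₀ μ)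
    (t₀ : UnitAddCircle)
    (α : ℂ) (hα : (α ^ 2).im = 0) (hαπ : (α ^ 2).re < Real.pi ^ 2) :
    -- `f_α` is a reparametrisation of `[0, 1]` with constant Schwarzian `2 α²`
    IsIntervalDiff3 (fAlpha α) ∧
    (∀ t ∈ Icc (0 : ℝ) 1, schwarzian (fAlpha α) t = 2 * (α ^ 2).re) ∧
    -- `f_α`, seen as a map of the circle, belongs to `Diff¹(𝕋)`
    ∃ f : CircleDiff,
      (∀ t ∈ Icc (0 : ℝ) 1, f (t : UnitAddCircle) = (fAlpha α t : UnitAddCircle)) ∧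
      -- the identity for nonnegative functionals
      (∀ G : CircleDiff → ℝ≥0∞, Measurable G →
        ∫⁻ φ, G (f.comp φ) ∂(pinned t₀ (orbitalFamily σ a₀ μ (α ^ 2).re))
          = ENNReal.ofReal (alphaDivSin α) *
            ∫⁻ φ, G φ * ENNReal.ofReal (Real.exp (defectCoeff α / σ ^ 2 * φ.derivative t₀))
              ∂(pinned t₀ (orbitalFamily σ a₀ μ 0))) ∧
      -- the identity for real functionals; both sides are integrable at the same time
      (∀ G : CircleDiff → ℝ, Measurable G →
        (Integrable (fun φ => G (f.comp φ)) (pinned t₀ (orbitalFamily σ a₀ μ (α ^ 2).re)) ↔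
          Integrable (fun φ => G φ * Real.exp (defectCoeff α / σ ^ 2 * φ.derivative t₀))
            (pinned t₀ (orbitalFamily σ a₀ μ 0))) ∧
        ∫ φ, G (f.comp φ) ∂(pinned t₀ (orbitalFamily σ a₀ μ (α ^ 2).re))
          = alphaDivSin α *
            ∫ φ, G φ * Real.exp (defectCoeff α / σ ^ 2 * φ.derivative t₀)
              ∂(pinned t₀ (orbitalFamily σ a₀ μ 0))) := by
  obtain ⟨C, S, h⟩ := IsComplexTrigPair.exists_of_sq_im_eq_zero hα hαπ
  rw [h.fAlpha_eq_tanMap, h.alphaDivSin_eq, h.defectCoeff_eq]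
  have hcomp : Measurable fun φ => h.diffeo.comp φ := (continuous_const_mul h.diffeo).measurable
  have hdefect : Measurable fun φ : CircleDiff =>
      8 * (α ^ 2).re * S (1 / 2) ^ 2 / σ ^ 2 * φ.derivative t₀ :=
    Continuous.measurable (by fun_prop)
  have hpos := h.diffeo.derivative_pos 0
  have hmap := h.map_pinned_orbitalFamily hμ t₀
  exact ⟨h.isIntervalDiff3_tanMap, fun t ht => h.schwarzian_tanMap ht, h.diffeo,
    fun t ht => h.diffeo_coe ht,
    fun G hG => lintegral_comp_of_map_eq_smul_expWeight hcomp hdefect hmap hG,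
    fun G hG => ⟨integrable_comp_iff_of_map_eq_smul_expWeight hcomp hdefect hpos hmap hG,
      integral_comp_of_map_eq_smul_expWeight hcomp hdefect hpos.le hmap hG⟩⟩

end
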